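/- Let $N\ge 2$ and let $\Omega\subseteq\mathbb R^N$ be a bounded domain with Lipschitz boundary. Let $p,q\in C(\overline\Omega)$ satisfy $1<p(x)<N$ and $p(x)<q(x)$ for all $x\in\overline\Omega$, and let $0\le\mu\in L^1(\Omega)$. Put $$\mathcal H(x,t)=t^{p(x)}+\mu(x)t^{q(x)}\quad(t\ge 0),\qquad \rho_{\mathcal H}(u)=\int_\Omega \mathcal H(x,|u(x)|)\,dx .$$ Let $L^{\mathcal H}(\Omega)$ be the space of (classes of) measurable functions $u$ on $\Omega$ such that $\rho_{\mathcal H}(\alpha u)<\infty$ for some $\alpha>0$, with the norm $\|u\|_{\mathcal H}=\inf\{\tau>0:\rho_{\mathcal H}(u/\tau)\le 1\}$. Let $W^{1,\mathcal H}(\Omega)$ be the space of all $u\in L^{\mathcal H}(\Omega)$ that have a weak gradient $\nabla u$ with $|\nabla u|\in L^{\mathcal H}(\Omega)$, with the norm $\|u\|_{1,\mathcal H}=\|u\|_{\mathcal H}+\|\,|\nabla u|\,\|_{\mathcal H}$, and let $W_0^{1,\mathcal H}(\Omega)$ be the closure of $C_0^\infty(\Omega)$ in $W^{1,\mathcal H}(\Omega)$.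 For $u,v\in W_0^{1,\mathcal H}(\Omega)$ consider $$I(u)=\int_\Omega\left(\frac{|\nabla u|^{p(x)}}{p(x)}+\mu(x)\frac{|\nabla u|^{q(x)}}{q(x)}\right)dx,$$ $$\langle A(u),v\rangle=\int_\Omega\left(|\nabla u|^{p(x)-2}\nabla u\cdot\nabla v+\mu(x)|\nabla u|^{q(x)-2}\nabla u\cdot\nabla v\right)dx .$$ Then the integrand of $I(u)$ is integrable for every $u\in W_0^{1,\mathcal H}(\Omega)$, so that $I\colon W_0^{1,\mathcal H}(\Omega)\to\mathbb R$ is well defined. Moreover, the integrand of $\langle A(u),v\rangle$ is integrable for all $u,v$, the functional $A(u)$ belongs to the dual space $W_0^{1,\mathcal H}(\Omega)^*$, and $I$ is of class $C^1$ with (Fréchet) derivative $I'(u)=A(u)$ for every $u\in W_0^{1,\mathcal H}(\Omega)$. -/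

import Mathlib

open MeasureTheory Set Filter Topology
open scoped NNReal ContDiff

set_option linter.unusedSectionVars false

namespace DoublePhase

/-! ## The standing hypothesis -/

/-- `Ω` has Lipschitz boundary: around every boundary point, in a suitable system of Cartesian
coordinates (the last axis is spanned by the unit vector `ν`, the others span its orthogonal
complement), `Ω` is the region strictly above the graph of a Lipschitz function `γ`. -/
def HasLipschitzBoundary {N : ℕ} (Ω : Set (EuclideanSpace ℝ (Fin N))) : Prop :=
  ∀ x ∈ frontier Ω, ∃ ν : EuclideanSpace ℝ (Fin N), ‖ν‖ = 1 ∧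
    ∃ (K : ℝ≥0) (γ : (ℝ ∙ ν)ᗮ → ℝ), LipschitzWith K γ ∧
      ∃ r > 0, ∀ y ∈ Metric.ball x r,
        y ∈ Ω ↔ γ ((ℝ ∙ ν)ᗮ.orthogonalProjectionOnto y) < inner ℝ ν y

/-- The standing hypothesis: `Ω ⊆ ℝ^N`, `N ≥ 2`, is a bounded domain with Lipschitz boundary,
`p, q` are continuous on the closure of `Ω` with `1 < p < N` and `p < q` there (so that also
`1 < q`), and `0 ≤ μ ∈ L¹(Ω)`. -/
structure Condition {N : ℕ} (Ω : Set (EuclideanSpace ℝ (Fin N)))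
    (p q μ : EuclideanSpace ℝ (Fin N) → ℝ) : Prop where
  two_le : 2 ≤ N
  isOpen : IsOpen Ω
  isConnected : IsConnected Ω
  isBounded : Bornology.IsBounded Ω
  lipschitzBoundary : HasLipschitzBoundary Ω
  continuousOn_p : ContinuousOn p (closure Ω)
  continuousOn_q : ContinuousOn q (closure Ω)
  one_lt_p : ∀ x ∈ closure Ω, 1 < p x
  p_lt : ∀ x ∈ closure Ω, p x < N
  p_lt_q : ∀ x ∈ closure Ω, p x < q x
  integrableOn_μ : IntegrableOn μ Ω
  μ_nonneg : ∀ᵐ x ∂(volume.restrict Ω), 0 ≤ μ x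

/-! ## The Musielak-Orlicz space `L^H(Ω)` -/

section Modular

variable {N : ℕ} (Ω : Set (EuclideanSpace ℝ (Fin N))) (p q μ : EuclideanSpace ℝ (Fin N) → ℝ)
  {F : Type*} [NormedAddCommGroup F] [NormedSpace ℝ F]

/-- The double phase function `H(x, t) = t ^ p(x) + μ(x) t ^ q(x)`. -/
noncomputable def phaseFun (x : EuclideanSpace ℝ (Fin N)) (t : ℝ) : ℝ :=
  t ^ p x + μ x * t ^ q x

/-- The modular `ρ_H(u) = ∫_Ω H(x, |u(x)|) dx`, with values in `[0, ∞]`. -/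
noncomputable def modular (u : EuclideanSpace ℝ (Fin N) → F) : ENNReal :=
  ∫⁻ x in Ω, ENNReal.ofReal (phaseFun p q μ x ‖u x‖)

/-- The Luxemburg norm `‖u‖_H = inf {τ > 0 : ρ_H(u / τ) ≤ 1}`. -/
noncomputable def luxNorm (u : EuclideanSpace ℝ (Fin N) → F) : ℝ :=
  sInf {τ : ℝ | 0 < τ ∧ modular Ω p q μ (fun x => τ⁻¹ • u x) ≤ 1}

/-- `ρ_H(α u) < ∞` for some `α > 0`. -/
def HasFiniteModular (u : EuclideanSpace ℝ (Fin N) → F) : Prop :=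
  ∃ α : ℝ, 0 < α ∧ modular Ω p q μ (fun x => α • u x) < ⊤

variable {Ω p q μ}

theorem modular_congr {u v : EuclideanSpace ℝ (Fin N) → F} (h : u =ᵐ[volume.restrict Ω] v) :
    modular Ω p q μ u = modular Ω p q μ v := by
  refine lintegral_congr_ae ?_
  filter_upwards [h] with x hx
  rw [hx]

theorem modular_smul_congr {u v : EuclideanSpace ℝ (Fin N) → F}
    (h : u =ᵐ[volume.restrict Ω] v) (c : ℝ) :
    modular Ω p q μ (fun x => c • u x) = modular Ω p q μ (fun x => c • v x) :=
  modular_congr (by filter_upwards [h] with x hx; rw [hx])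

theorem luxNorm_congr {u v : EuclideanSpace ℝ (Fin N) → F} (h : u =ᵐ[volume.restrict Ω] v) :
    luxNorm Ω p q μ u = luxNorm Ω p q μ v := by
  unfold luxNorm
  congr 1
  ext τ
  simp only [mem_ofPred_eq, modular_smul_congr h]

theorem HasFiniteModular.congr {u v : EuclideanSpace ℝ (Fin N) → F}
    (hu : HasFiniteModular Ω p q μ u) (h : u =ᵐ[volume.restrict Ω] v) :
    HasFiniteModular Ω p q μ v := by
  obtain ⟨α, hα, hf⟩ := hu
  exact ⟨α, hα, by rwa [← modular_smul_congr h]⟩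

theorem modular_smul_of_norm (u : EuclideanSpace ℝ (Fin N) → F) {c d : ℝ} (h : |c| = |d|) :
    modular Ω p q μ (fun x => c • u x) = modular Ω p q μ (fun x => d • u x) := by
  simp only [modular, norm_smul, Real.norm_eq_abs, h]

theorem luxNorm_nonneg (u : EuclideanSpace ℝ (Fin N) → F) : 0 ≤ luxNorm Ω p q μ u :=
  Real.sInf_nonneg fun _ hτ => hτ.1.le

theorem luxNorm_le {u : EuclideanSpace ℝ (Fin N) → F} {τ : ℝ} (hτ : 0 < τ)
    (h : modular Ω p q μ (fun x => τ⁻¹ • u x) ≤ 1) : luxNorm Ω p q μ u ≤ τ :=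
  csInf_le ⟨0, fun _ hx => hx.1.le⟩ ⟨hτ, h⟩

theorem luxNorm_smul_le_aux (u : EuclideanSpace ℝ (Fin N) → F) {c : ℝ} (hc : c ≠ 0) {τ : ℝ}
    (hτ : 0 < τ) (h : modular Ω p q μ (fun x => τ⁻¹ • u x) ≤ 1) :
    luxNorm Ω p q μ (fun x => c • u x) ≤ |c| * τ := by
  refine luxNorm_le (by positivity) ?_
  simp only [smul_smul]
  rwa [modular_smul_of_norm u (d := τ⁻¹)]
  have : |c| ≠ 0 := abs_ne_zero.2 hc
  simp only [abs_mul, abs_inv, abs_abs]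
  field_simp

namespace Condition

theorem ae_bounds (h : Condition Ω p q μ) : ∀ᵐ x ∂(volume.restrict Ω), 1 < p x ∧ 1 < q x ∧ 0 ≤ μ x := by
  filter_upwards [h.μ_nonneg, ae_restrict_mem h.isOpen.measurableSet] with x hμ hx
  have h1 := h.one_lt_p x (subset_closure hx)
  exact ⟨h1, h1.trans (h.p_lt_q x (subset_closure hx)), hμ⟩

theorem aemeasurable_phaseFun (h : Condition Ω p q μ) {u : EuclideanSpace ℝ (Fin N) → F}
    (hu : AEStronglyMeasurable u (volume.restrict Ω)) :
    AEMeasurable (fun x => phaseFun p q μ x ‖u x‖) (volume.restrict Ω) := by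
  have hp : AEMeasurable p (volume.restrict Ω) :=
    (h.continuousOn_p.mono subset_closure).aemeasurable h.isOpen.measurableSet
  have hq : AEMeasurable q (volume.restrict Ω) :=
    (h.continuousOn_q.mono subset_closure).aemeasurable h.isOpen.measurableSet
  have hμ : AEMeasurable μ (volume.restrict Ω) := h.integrableOn_μ.aemeasurable
  have hn : AEMeasurable (fun x => ‖u x‖) (volume.restrict Ω) := hu.norm.aemeasurable
  exact (hn.pow hp).add (hμ.mul (hn.pow hq))

theorem phaseFun_convex {x : EuclideanSpace ℝ (Fin N)} (hx : 1 < p x ∧ 1 < q x ∧ 0 ≤ μ x)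
    {s t r a b : ℝ} (hr : 0 ≤ r) (hs : 0 ≤ s) (ht : 0 ≤ t) (ha : 0 ≤ a) (hb : 0 ≤ b)
    (hab : a + b = 1) (hle : r ≤ a * s + b * t) :
    phaseFun p q μ x r ≤ a * phaseFun p q μ x s + b * phaseFun p q μ x t := by
  obtain ⟨hp, hq, hμ⟩ := hx
  have key : ∀ e : ℝ, 1 < e → r ^ e ≤ a * s ^ e + b * t ^ e := fun e he =>
    (Real.rpow_le_rpow hr hle (by linarith)).trans
      (by simpa using (convexOn_rpow he.le).2 (mem_Ici.2 hs) (mem_Ici.2 ht) ha hb hab)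
  have h1 := key _ hp
  have h2 := mul_le_mul_of_nonneg_left (key _ hq) hμ
  unfold phaseFun
  linarith

theorem phaseFun_nonneg {x : EuclideanSpace ℝ (Fin N)} (hx : 1 < p x ∧ 1 < q x ∧ 0 ≤ μ x)
    {t : ℝ} (ht : 0 ≤ t) : 0 ≤ phaseFun p q μ x t :=
  add_nonneg (Real.rpow_nonneg ht _) (mul_nonneg hx.2.2 (Real.rpow_nonneg ht _))

/-- Convexity of the modular. -/
theorem modular_convex (h : Condition Ω p q μ) {u v w : EuclideanSpace ℝ (Fin N) → F}
    (hu : AEStronglyMeasurable u (volume.restrict Ω)) {a b : ℝ} (ha : 0 ≤ a) (hb : 0 ≤ b)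
    (hab : a + b = 1) (hw : ∀ x, w x = a • u x + b • v x) :
    modular Ω p q μ w ≤
      ENNReal.ofReal a * modular Ω p q μ u + ENNReal.ofReal b * modular Ω p q μ v := by
  unfold modular
  rw [← lintegral_const_mul' _ _ ENNReal.ofReal_ne_top,
    ← lintegral_const_mul' _ _ ENNReal.ofReal_ne_top,
    ← lintegral_add_left' ((h.aemeasurable_phaseFun hu).ennreal_ofReal.const_mul _)]
  refine lintegral_mono_ae ?_
  filter_upwards [h.ae_bounds] with x hx
  rw [← ENNReal.ofReal_mul ha, ← ENNReal.ofReal_mul hb, ← ENNReal.ofReal_add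
    (mul_nonneg ha (phaseFun_nonneg hx (norm_nonneg _)))
    (mul_nonneg hb (phaseFun_nonneg hx (norm_nonneg _)))]
  refine ENNReal.ofReal_le_ofReal (phaseFun_convex hx (norm_nonneg _) (norm_nonneg _)
    (norm_nonneg _) ha hb hab ?_)
  rw [hw x]
  refine (norm_add_le _ _).trans ?_
  simp only [norm_smul, Real.norm_eq_abs, abs_of_nonneg ha, abs_of_nonneg hb, le_refl]

theorem modular_zero (h : Condition Ω p q μ) : modular Ω p q μ (fun _ => (0 : F)) = 0 := by
  unfold modular
  rw [lintegral_congr_ae (g := fun _ => 0), lintegral_zero]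
  filter_upwards [h.ae_bounds] with x hx
  simp [phaseFun, Real.zero_rpow (by linarith : p x ≠ 0), Real.zero_rpow (by linarith : q x ≠ 0)]

/-- `ρ_H(c u) ≤ c ρ_H(u)` for `0 ≤ c ≤ 1`. -/
theorem modular_smul_le (h : Condition Ω p q μ) (u : EuclideanSpace ℝ (Fin N) → F) {c : ℝ} (hc : 0 ≤ c) (hc1 : c ≤ 1) :
    modular Ω p q μ (fun x => c • u x) ≤ ENNReal.ofReal c * modular Ω p q μ u := by
  have := h.modular_convex (u := fun _ => (0 : F)) (v := u) (w := fun x => c • u x)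
    aestronglyMeasurable_const (a := 1 - c) (b := c) (by linarith) hc (by ring) (by simp)
  simpa [h.modular_zero] using this

theorem luxNorm_set_nonempty (h : Condition Ω p q μ) {u : EuclideanSpace ℝ (Fin N) → F}
    (hu : HasFiniteModular Ω p q μ u) :
    {τ : ℝ | 0 < τ ∧ modular Ω p q μ (fun x => τ⁻¹ • u x) ≤ 1}.Nonempty := by
  obtain ⟨α, hα, hf⟩ := hu
  set m := (modular Ω p q μ (fun x => α • u x)).toReal with hm
  have hm0 : 0 ≤ m := ENNReal.toReal_nonneg
  refine ⟨(m + 1) * α⁻¹, by positivity, ?_⟩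
  have h1 := h.modular_smul_le (fun x => α • u x) (c := (m + 1)⁻¹) (by positivity)
    (inv_le_one_of_one_le₀ (by linarith))
  have h2 : (fun x => ((m + 1) * α⁻¹)⁻¹ • u x) = fun x => (m + 1)⁻¹ • α • u x := by
    funext x; rw [smul_smul, mul_inv, inv_inv]
  rw [h2]
  refine h1.trans ?_
  rw [← ENNReal.ofReal_toReal (a := modular Ω p q μ (fun x => α • u x)) hf.ne, ← hm, ← ENNReal.ofReal_mul (by positivity),
    ENNReal.ofReal_le_one, inv_mul_le_iff₀ (by positivity)]
  linarith

theorem luxNorm_add_le (h : Condition Ω p q μ) {u v : EuclideanSpace ℝ (Fin N) → F}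
    (hum : AEStronglyMeasurable u (volume.restrict Ω))
    (hu : HasFiniteModular Ω p q μ u) (hv : HasFiniteModular Ω p q μ v) :
    luxNorm Ω p q μ (fun x => u x + v x) ≤ luxNorm Ω p q μ u + luxNorm Ω p q μ v := by
  refine le_of_forall_pos_le_add fun ε hε => ?_
  obtain ⟨s, ⟨hs, hs1⟩, hs2⟩ := Real.lt_sInf_add_pos (h.luxNorm_set_nonempty hu) (half_pos hε)
  obtain ⟨t, ⟨ht, ht1⟩, ht2⟩ := Real.lt_sInf_add_pos (h.luxNorm_set_nonempty hv) (half_pos hε)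
  have hst : luxNorm Ω p q μ (fun x => u x + v x) ≤ s + t := by
    refine luxNorm_le (by positivity) ?_
    have hab : s / (s + t) + t / (s + t) = 1 := by field_simp
    refine (h.modular_convex (hum.const_smul s⁻¹) (v := fun x => t⁻¹ • v x)
      (a := s / (s + t)) (b := t / (s + t)) (by positivity) (by positivity) hab ?_).trans ?_
    · intro x
      simp only [Pi.smul_apply, smul_smul, smul_add]
      congr 2 <;> field_simp
    · calc _ ≤ ENNReal.ofReal (s / (s + t)) * 1 + ENNReal.ofReal (t / (s + t)) * 1 := by
            gcongr
            exact hs1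
        _ = 1 := by
            rw [mul_one, mul_one, ← ENNReal.ofReal_add (by positivity) (by positivity), hab,
              ENNReal.ofReal_one]
  have e1 : sInf {τ : ℝ | 0 < τ ∧ modular Ω p q μ (fun x => τ⁻¹ • u x) ≤ 1} =
    luxNorm Ω p q μ u := rfl
  have e2 : sInf {τ : ℝ | 0 < τ ∧ modular Ω p q μ (fun x => τ⁻¹ • v x) ≤ 1} =
    luxNorm Ω p q μ v := rfl
  linarith

theorem luxNorm_smul_le (h : Condition Ω p q μ) {u : EuclideanSpace ℝ (Fin N) → F} (hu : HasFiniteModular Ω p q μ u)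
    {c : ℝ} (hc : c ≠ 0) :
    luxNorm Ω p q μ (fun x => c • u x) ≤ |c| * luxNorm Ω p q μ u := by
  have hc' : 0 < |c| := abs_pos.2 hc
  rw [← div_le_iff₀' hc']
  refine le_csInf (h.luxNorm_set_nonempty hu) fun τ hτ => ?_
  rw [div_le_iff₀' hc']
  exact luxNorm_smul_le_aux u hc hτ.1 hτ.2

theorem luxNorm_zero (h : Condition Ω p q μ) : luxNorm Ω p q μ (fun _ => (0 : F)) = 0 := by
  refine le_antisymm (le_of_forall_pos_le_add fun ε hε => ?_) (luxNorm_nonneg _)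
  rw [zero_add]
  exact luxNorm_le hε (by simp [h.modular_zero])

theorem hasFiniteModular_smul {u : EuclideanSpace ℝ (Fin N) → F}
    (hu : HasFiniteModular Ω p q μ u) {c : ℝ} (hc : c ≠ 0) :
    HasFiniteModular Ω p q μ (fun x => c • u x) := by
  obtain ⟨α, hα, hf⟩ := hu
  have hc' : 0 < |c| := abs_pos.2 hc
  refine ⟨α / |c|, by positivity, ?_⟩
  simp only [smul_smul]
  rwa [modular_smul_of_norm u (d := α)]
  rw [abs_mul, abs_div, abs_abs]
  field_simp

theorem hasFiniteModular_zero (h : Condition Ω p q μ) : HasFiniteModular Ω p q μ (fun _ => (0 : F)) :=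
  ⟨1, one_pos, by simp [h.modular_zero]⟩

theorem hasFiniteModular_add (h : Condition Ω p q μ) {u v : EuclideanSpace ℝ (Fin N) → F}
    (hum : AEStronglyMeasurable u (volume.restrict Ω))
    (hu : HasFiniteModular Ω p q μ u) (hv : HasFiniteModular Ω p q μ v) :
    HasFiniteModular Ω p q μ (fun x => u x + v x) := by
  obtain ⟨s, hs, hs1⟩ := h.luxNorm_set_nonempty hu
  obtain ⟨t, ht, ht1⟩ := h.luxNorm_set_nonempty hv
  refine ⟨(s + t)⁻¹, by positivity, ?_⟩
  have hab : s / (s + t) + t / (s + t) = 1 := by field_simp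
  refine (h.modular_convex (hum.const_smul s⁻¹) (v := fun x => t⁻¹ • v x)
    (a := s / (s + t)) (b := t / (s + t)) (by positivity) (by positivity) hab ?_).trans_lt ?_
  · intro x
    simp only [Pi.smul_apply, smul_smul, smul_add]
    congr 2 <;> field_simp
  · exact ENNReal.add_lt_top.2
      ⟨ENNReal.mul_lt_top ENNReal.ofReal_lt_top (hs1.trans_lt ENNReal.one_lt_top),
        ENNReal.mul_lt_top ENNReal.ofReal_lt_top (ht1.trans_lt ENNReal.one_lt_top)⟩

theorem luxNorm_smul (h : Condition Ω p q μ) {u : EuclideanSpace ℝ (Fin N) → F} (hu : HasFiniteModular Ω p q μ u)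
    (c : ℝ) : luxNorm Ω p q μ (fun x => c • u x) = |c| * luxNorm Ω p q μ u := by
  rcases eq_or_ne c 0 with rfl | hc
  · simp [h.luxNorm_zero]
  refine le_antisymm (h.luxNorm_smul_le hu hc) ?_
  have h1 := h.luxNorm_smul_le (hasFiniteModular_smul hu hc) (inv_ne_zero hc)
  simp only [smul_smul, inv_mul_cancel₀ hc, one_smul, abs_inv] at h1
  rwa [← le_inv_mul_iff₀ (abs_pos.2 hc)]

/-- Functions with finite modular are integrable over the bounded set `Ω`. -/
theorem integrable_of_hasFiniteModular (h : Condition Ω p q μ) {u : EuclideanSpace ℝ (Fin N) → F}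
    (hum : AEStronglyMeasurable u (volume.restrict Ω)) (hu : HasFiniteModular Ω p q μ u) :
    IntegrableOn u Ω := by
  obtain ⟨α, hα, hf⟩ := hu
  have hI : Integrable (fun x => phaseFun p q μ x ‖α • u x‖) (volume.restrict Ω) := by
    refine ⟨(h.aemeasurable_phaseFun (hum.const_smul α)).aestronglyMeasurable, ?_⟩
    rw [hasFiniteIntegral_iff_ofReal]
    · exact hf
    · filter_upwards [h.ae_bounds] with x hx using phaseFun_nonneg hx (norm_nonneg _)
  have hfin : volume Ω < ⊤ := h.isBounded.measure_lt_top
  have h1 : Integrable (fun _ : EuclideanSpace ℝ (Fin N) => (1 : ℝ)) (volume.restrict Ω) :=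
    integrableOn_const hfin.ne
  have h2 : Integrable (fun x => α • u x) (volume.restrict Ω) := by
    refine (h1.add hI).mono' (hum.const_smul α) ?_
    filter_upwards [h.ae_bounds] with x hx
    have hq : 0 ≤ μ x * ‖α • u x‖ ^ q x := mul_nonneg hx.2.2 (Real.rpow_nonneg (norm_nonneg _) _)
    simp only [Pi.add_apply, phaseFun]
    rcases le_total ‖α • u x‖ 1 with h3 | h3
    · have := Real.rpow_nonneg (norm_nonneg (α • u x)) (p x)
      linarith
    · have := Real.self_le_rpow_of_one_le h3 hx.1.le
      linarith
  have h3 := h2.smul α⁻¹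
  refine h3.congr (Eventually.of_forall fun x => ?_)
  simp [smul_smul, inv_mul_cancel₀ hα.ne']

theorem ae_eq_zero_of_luxNorm_eq_zero (h : Condition Ω p q μ) {u : EuclideanSpace ℝ (Fin N) → F}
    (hum : AEStronglyMeasurable u (volume.restrict Ω))
    (hu : HasFiniteModular Ω p q μ u) (h0 : luxNorm Ω p q μ u = 0) :
    u =ᵐ[volume.restrict Ω] 0 := by
  have hle : ∀ ε : ℝ, 0 < ε → ε ≤ 1 → modular Ω p q μ u ≤ ENNReal.ofReal ε := by
    intro ε hε hε1
    obtain ⟨τ, ⟨hτ, hτ1⟩, hτ2⟩ := Real.lt_sInf_add_pos (h.luxNorm_set_nonempty hu) hε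
    have e1 : sInf {τ : ℝ | 0 < τ ∧ modular Ω p q μ (fun x => τ⁻¹ • u x) ≤ 1} =
      luxNorm Ω p q μ u := rfl
    rw [e1, h0, zero_add] at hτ2
    have h2 := h.modular_smul_le (fun x => τ⁻¹ • u x) hτ.le (hτ2.le.trans hε1)
    simp only [smul_smul, mul_inv_cancel₀ hτ.ne', one_smul] at h2
    calc modular Ω p q μ u ≤ ENNReal.ofReal τ * 1 := h2.trans (by gcongr)
      _ ≤ ENNReal.ofReal ε := by rw [mul_one]; exact ENNReal.ofReal_le_ofReal hτ2.le
  have hz : modular Ω p q μ u = 0 := by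
    refine le_antisymm (ENNReal.le_of_forall_pos_le_add fun ε hε _ => ?_) zero_le
    have := hle (min ε 1) (lt_min hε one_pos) (min_le_right _ _)
    rw [zero_add]
    refine this.trans ((ENNReal.ofReal_le_ofReal (min_le_left _ _)).trans ?_)
    simp
  unfold modular at hz
  rw [lintegral_eq_zero_iff' (h.aemeasurable_phaseFun hum).ennreal_ofReal] at hz
  filter_upwards [hz, h.ae_bounds] with x hx hb
  simp only [Pi.zero_apply, ENNReal.ofReal_eq_zero, phaseFun] at hx
  have hq : 0 ≤ μ x * ‖u x‖ ^ q x := mul_nonneg hb.2.2 (Real.rpow_nonneg (norm_nonneg _) _)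
  have hp := Real.rpow_nonneg (norm_nonneg (u x)) (p x)
  have : ‖u x‖ ^ p x = 0 := by linarith
  simpa using ((Real.rpow_eq_zero (norm_nonneg _) (by linarith)).1 this)

end Condition

end Modular

/-! ### `L^H(Ω; F)` as a normed space -/

section Space

variable {N : ℕ} {Ω : Set (EuclideanSpace ℝ (Fin N))} {p q μ : EuclideanSpace ℝ (Fin N) → ℝ}

/-- The Musielak-Orlicz space `L^H(Ω; F)` of (classes of) measurable functions `u` on `Ω` with
`ρ_H(α u) < ∞` for some `α > 0`; `F = ℝ` gives `L^H(Ω)`, and `F = ℝ^N` is used for gradients. -/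
def LH (h : Condition Ω p q μ) (F : Type*) [NormedAddCommGroup F] [NormedSpace ℝ F] :
    Submodule ℝ (EuclideanSpace ℝ (Fin N) →ₘ[volume.restrict Ω] F) where
  carrier := {u | HasFiniteModular Ω p q μ u}
  zero_mem' := h.hasFiniteModular_zero.congr AEEqFun.coeFn_zero.symm
  add_mem' := fun {u v} hu hv =>
    (h.hasFiniteModular_add u.aestronglyMeasurable hu hv).congr (AEEqFun.coeFn_add u v).symm
  smul_mem' := fun c u hu => by
    rcases eq_or_ne c 0 with rfl | hc
    · rw [zero_smul]
      exact h.hasFiniteModular_zero.congr AEEqFun.coeFn_zero.symm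
    · exact (Condition.hasFiniteModular_smul hu hc).congr (AEEqFun.coeFn_smul c u).symm

variable {h : Condition Ω p q μ} {F : Type*} [NormedAddCommGroup F] [NormedSpace ℝ F]

noncomputable instance : Norm (LH h F) where
  norm u := luxNorm Ω p q μ (u : EuclideanSpace ℝ (Fin N) →ₘ[volume.restrict Ω] F)

theorem LH.norm_def (u : LH h F) : ‖u‖ =
    luxNorm Ω p q μ (u : EuclideanSpace ℝ (Fin N) →ₘ[volume.restrict Ω] F) := rfl

theorem LH.core : NormedSpace.Core ℝ (LH h F) where
  norm_nonneg u := luxNorm_nonneg _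
  norm_smul c u := by
    rw [LH.norm_def, LH.norm_def, Real.norm_eq_abs, ← h.luxNorm_smul u.2 c]
    exact luxNorm_congr (AEEqFun.coeFn_smul c u.1)
  norm_triangle u v := by
    rw [LH.norm_def, LH.norm_def, LH.norm_def]
    exact (luxNorm_congr (AEEqFun.coeFn_add u.1 v.1)).trans_le
      (h.luxNorm_add_le u.1.aestronglyMeasurable u.2 v.2)
  norm_eq_zero_iff u := by
    constructor
    · intro h0
      refine Subtype.ext (AEEqFun.ext ?_)
      exact (h.ae_eq_zero_of_luxNorm_eq_zero u.1.aestronglyMeasurable u.2 h0).trans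
        AEEqFun.coeFn_zero.symm
    · rintro rfl
      rw [LH.norm_def, ← h.luxNorm_zero (F := F)]
      exact luxNorm_congr AEEqFun.coeFn_zero

noncomputable instance : NormedAddCommGroup (LH h F) := NormedAddCommGroup.ofCore LH.core

noncomputable instance : NormedSpace ℝ (LH h F) := NormedSpace.ofCore LH.core

theorem LH.integrableOn (u : LH h F) :
    IntegrableOn (u : EuclideanSpace ℝ (Fin N) →ₘ[volume.restrict Ω] F) Ω :=
  h.integrable_of_hasFiniteModular u.1.aestronglyMeasurable u.2

end Space

/-! ## The Sobolev spaces `W^{1,H}(Ω)` and `W₀^{1,H}(Ω)` -/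

section Sobolev

variable {N : ℕ}

/-- Test functions: `φ ∈ C₀^∞(Ω)`. -/
structure IsTestFunction (Ω : Set (EuclideanSpace ℝ (Fin N)))
    (φ : EuclideanSpace ℝ (Fin N) → ℝ) : Prop where
  contDiff : ContDiff ℝ ∞ φ
  hasCompactSupport : HasCompactSupport φ
  tsupport_subset : tsupport φ ⊆ Ω

/-- `g` is the weak (distributional) gradient of `u` in `Ω`. -/
def IsWeakGradient (Ω : Set (EuclideanSpace ℝ (Fin N))) (u : EuclideanSpace ℝ (Fin N) → ℝ)
    (g : EuclideanSpace ℝ (Fin N) → EuclideanSpace ℝ (Fin N)) : Prop :=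
  ∀ φ, IsTestFunction Ω φ → ∫ x in Ω, u x • gradient φ x = - ∫ x in Ω, φ x • g x

theorem IsTestFunction.continuous_gradient {Ω : Set (EuclideanSpace ℝ (Fin N))}
    {φ : EuclideanSpace ℝ (Fin N) → ℝ} (hφ : IsTestFunction Ω φ) : Continuous (gradient φ) :=
  (InnerProductSpace.toDual ℝ (EuclideanSpace ℝ (Fin N))).symm.continuous.comp
    (hφ.contDiff.continuous_fderiv (by simp))

theorem IsTestFunction.hasCompactSupport_gradient {Ω : Set (EuclideanSpace ℝ (Fin N))}
    {φ : EuclideanSpace ℝ (Fin N) → ℝ} (hφ : IsTestFunction Ω φ) :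
    HasCompactSupport (gradient φ) :=
  (hφ.hasCompactSupport.fderiv (𝕜 := ℝ)).comp_left (map_zero _)

variable {Ω : Set (EuclideanSpace ℝ (Fin N))} {p q μ : EuclideanSpace ℝ (Fin N) → ℝ}

theorem LH.integrable_smul_gradient {h : Condition Ω p q μ} (u : LH h ℝ)
    {φ : EuclideanSpace ℝ (Fin N) → ℝ} (hφ : IsTestFunction Ω φ) :
    Integrable (fun x => u.1 x • gradient φ x) (volume.restrict Ω) := by
  obtain ⟨C, hC⟩ := hφ.hasCompactSupport_gradient.exists_bound_of_continuous hφ.continuous_gradient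
  exact Integrable.smul_bdd (LH.integrableOn u) C hφ.continuous_gradient.aestronglyMeasurable
    (Eventually.of_forall hC)

theorem LH.integrable_smul_test {h : Condition Ω p q μ} (g : LH h (EuclideanSpace ℝ (Fin N)))
    {φ : EuclideanSpace ℝ (Fin N) → ℝ} (hφ : IsTestFunction Ω φ) :
    Integrable (fun x => φ x • g.1 x) (volume.restrict Ω) := by
  obtain ⟨C, hC⟩ := hφ.hasCompactSupport.exists_bound_of_continuous hφ.contDiff.continuous
  exact Integrable.bdd_smul (LH.integrableOn g) C hφ.contDiff.continuous.aestronglyMeasurable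
    (Eventually.of_forall hC)

/-- The Sobolev space `W^{1,H}(Ω)` of the functions `u ∈ L^H(Ω)` that have a weak gradient `∇u`
with `|∇u| ∈ L^H(Ω)`. An element is recorded as the pair `(u, ∇u)`, in which the second entry is
determined by the first (`weakGradient_unique`); the norm, inherited from the `ℓ¹`-product, is
`‖u‖_H + ‖∇u‖_H`. -/
def W1H (h : Condition Ω p q μ) :
    Submodule ℝ (WithLp 1 (LH h ℝ × LH h (EuclideanSpace ℝ (Fin N)))) where
  carrier := {w | IsWeakGradient Ω w.fst.1 w.snd.1}
  zero_mem' := fun φ _ => by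
    have h1 : ∫ x in Ω, (0 : EuclideanSpace ℝ (Fin N) →ₘ[volume.restrict Ω] ℝ) x • gradient φ x
        = 0 := by
      rw [integral_congr_ae (g := fun _ => 0), integral_zero]
      filter_upwards [AEEqFun.coeFn_zero (α := EuclideanSpace ℝ (Fin N))
        (μ := volume.restrict Ω) (β := ℝ)] with x hx
      simp [hx]
    have h2 : ∫ x in Ω, φ x • (0 : EuclideanSpace ℝ (Fin N) →ₘ[volume.restrict Ω]
        EuclideanSpace ℝ (Fin N)) x = 0 := by
      rw [integral_congr_ae (g := fun _ => 0), integral_zero]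
      filter_upwards [AEEqFun.coeFn_zero (α := EuclideanSpace ℝ (Fin N))
        (μ := volume.restrict Ω) (β := EuclideanSpace ℝ (Fin N))] with x hx
      simp [hx]
    exact h1.trans (by rw [← neg_zero, ← h2]; rfl)
  add_mem' := fun {w z} hw hz φ hφ => by
    have h1 : ∫ x in Ω, (w + z).fst.1 x • gradient φ x =
        (∫ x in Ω, w.fst.1 x • gradient φ x) + ∫ x in Ω, z.fst.1 x • gradient φ x := by
      rw [← integral_add (LH.integrable_smul_gradient w.fst hφ) (LH.integrable_smul_gradient z.fst hφ)]
      refine integral_congr_ae ?_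
      filter_upwards [AEEqFun.coeFn_add w.fst.1 z.fst.1] with x hx
      rw [← add_smul]
      exact congrArg (· • gradient φ x) hx
    have h2 : ∫ x in Ω, φ x • (w + z).snd.1 x =
        (∫ x in Ω, φ x • w.snd.1 x) + ∫ x in Ω, φ x • z.snd.1 x := by
      rw [← integral_add (LH.integrable_smul_test w.snd hφ) (LH.integrable_smul_test z.snd hφ)]
      refine integral_congr_ae ?_
      filter_upwards [AEEqFun.coeFn_add w.snd.1 z.snd.1] with x hx
      rw [← smul_add]
      exact congrArg (φ x • ·) hx
    rw [h1, h2, hw φ hφ, hz φ hφ, neg_add]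
  smul_mem' := fun c w hw φ hφ => by
    have h1 : ∫ x in Ω, (c • w).fst.1 x • gradient φ x =
        c • ∫ x in Ω, w.fst.1 x • gradient φ x := by
      rw [← integral_smul]
      refine integral_congr_ae ?_
      filter_upwards [AEEqFun.coeFn_smul c w.fst.1] with x hx
      rw [← smul_assoc]
      exact congrArg (· • gradient φ x) hx
    have h2 : ∫ x in Ω, φ x • (c • w).snd.1 x = c • ∫ x in Ω, φ x • w.snd.1 x := by
      rw [← integral_smul]
      refine integral_congr_ae ?_
      filter_upwards [AEEqFun.coeFn_smul c w.snd.1] with x hx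
      rw [smul_comm]
      exact congrArg (φ x • ·) hx
    rw [h1, h2, hw φ hφ, smul_neg]

/-- A function in `L^H(Ω)` has at most one weak gradient in `L^H(Ω)`. -/
theorem weakGradient_unique {h : Condition Ω p q μ} {w z : WithLp 1 (LH h ℝ ×
    LH h (EuclideanSpace ℝ (Fin N)))} (hw : w ∈ W1H h) (hz : z ∈ W1H h)
    (hwz : w.fst = z.fst) : w.snd = z.snd := by
  refine Subtype.ext (AEEqFun.ext ?_)
  have hloc : LocallyIntegrableOn (fun x => w.snd.1 x - z.snd.1 x) Ω :=
    IntegrableOn.locallyIntegrableOn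
      (Integrable.sub (μ := volume.restrict Ω) (LH.integrableOn w.snd) (LH.integrableOn z.snd))
  have := h.isOpen.ae_eq_zero_of_integral_contDiff_smul_eq_zero hloc fun φ h1 h2 h3 => by
    have hφ : IsTestFunction Ω φ := ⟨h1, h2, h3⟩
    have e1 := hw φ hφ
    rw [hwz, hz φ hφ, neg_inj] at e1
    rw [← setIntegral_eq_integral_of_forall_compl_eq_zero (s := Ω)]
    · simp only [smul_sub]
      rw [integral_sub (LH.integrable_smul_test w.snd hφ) (LH.integrable_smul_test z.snd hφ), e1,
        sub_self]
    · intro x hx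
      rw [image_eq_zero_of_notMem_tsupport fun hx' => hx (h3 hx'), zero_smul]
  rw [EventuallyEq, ae_restrict_iff' h.isOpen.measurableSet]
  filter_upwards [this] with x hx hxΩ using sub_eq_zero.1 (hx hxΩ)

theorem IsTestFunction.add {φ ψ : EuclideanSpace ℝ (Fin N) → ℝ} (hφ : IsTestFunction Ω φ)
    (hψ : IsTestFunction Ω ψ) : IsTestFunction Ω (φ + ψ) where
  contDiff := hφ.contDiff.add hψ.contDiff
  hasCompactSupport := hφ.hasCompactSupport.add hψ.hasCompactSupport
  tsupport_subset := (closure_mono (Function.support_add φ ψ)).trans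
    (by rw [closure_union]; exact union_subset hφ.tsupport_subset hψ.tsupport_subset)

theorem IsTestFunction.smul {φ : EuclideanSpace ℝ (Fin N) → ℝ} (hφ : IsTestFunction Ω φ)
    (c : ℝ) : IsTestFunction Ω (c • φ) where
  contDiff := hφ.contDiff.const_smul c
  hasCompactSupport := HasCompactSupport.smul_left (f := fun _ => c) hφ.hasCompactSupport
  tsupport_subset := (tsupport_smul_subset_right (fun _ => c) φ).trans hφ.tsupport_subset

theorem IsTestFunction.zero : IsTestFunction Ω (0 : EuclideanSpace ℝ (Fin N) → ℝ) where
  contDiff := contDiff_const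
  hasCompactSupport := HasCompactSupport.zero
  tsupport_subset := by simp [tsupport]

/-- `C₀^∞(Ω)` as a subspace of `W^{1,H}(Ω)` (the gradient component of an element is
automatically the gradient of `φ`, and every `φ` occurs: see `exists_mem_testSubmodule`). -/
def testSubmodule (h : Condition Ω p q μ) : Submodule ℝ (W1H h) where
  carrier := {w | ∃ φ, IsTestFunction Ω φ ∧ w.1.fst.1 =ᵐ[volume.restrict Ω] φ}
  zero_mem' := ⟨0, IsTestFunction.zero, AEEqFun.coeFn_zero⟩
  add_mem' := by
    rintro w z ⟨φ, hφ, hw⟩ ⟨ψ, hψ, hz⟩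
    exact ⟨φ + ψ, hφ.add hψ, (AEEqFun.coeFn_add w.1.fst.1 z.1.fst.1).trans (hw.add hz)⟩
  smul_mem' := by
    rintro c w ⟨φ, hφ, hw⟩
    exact ⟨c • φ, hφ.smul c, (AEEqFun.coeFn_smul c w.1.fst.1).trans (hw.const_smul c)⟩

/-- Bounded functions have finite modular. -/
theorem Condition.hasFiniteModular_of_bounded (h : Condition Ω p q μ) {F : Type*}
    [NormedAddCommGroup F] [NormedSpace ℝ F] {u : EuclideanSpace ℝ (Fin N) → F} {C : ℝ}
    (hC : ∀ x, ‖u x‖ ≤ C) : HasFiniteModular Ω p q μ u := by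
  have hC0 : 0 ≤ C := (norm_nonneg _).trans (hC 0)
  refine ⟨(C + 1)⁻¹, by positivity, ?_⟩
  have hI : Integrable (fun x => 1 + μ x) (volume.restrict Ω) :=
    Integrable.add (integrableOn_const (h.isBounded.measure_lt_top).ne) h.integrableOn_μ
  refine lt_of_le_of_lt (lintegral_mono_ae ?_) hI.lintegral_lt_top
  filter_upwards [h.ae_bounds] with x hx
  refine ENNReal.ofReal_le_ofReal ?_
  have h1 : ‖(C + 1)⁻¹ • u x‖ ≤ 1 := by
    rw [norm_smul, Real.norm_of_nonneg (by positivity), inv_mul_le_iff₀ (by positivity)]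
    linarith [hC x]
  unfold phaseFun
  have h2 := Real.rpow_le_one (z := p x) (norm_nonneg _) h1 (by linarith)
  have h3 := mul_le_of_le_one_right hx.2.2
    (Real.rpow_le_one (z := q x) (norm_nonneg _) h1 (by linarith))
  linarith

/-- The gradient of a test function is its weak gradient. -/
theorem IsTestFunction.isWeakGradient {φ : EuclideanSpace ℝ (Fin N) → ℝ}
    (hφ : IsTestFunction Ω φ) : IsWeakGradient Ω φ (gradient φ) := by
  intro ψ hψ
  rw [setIntegral_eq_integral_of_forall_compl_eq_zero (fun x hx => by
      rw [image_eq_zero_of_notMem_tsupport fun hx' => hx (hφ.tsupport_subset hx'), zero_smul]),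
    setIntegral_eq_integral_of_forall_compl_eq_zero (fun x hx => by
      rw [image_eq_zero_of_notMem_tsupport fun hx' => hx (hψ.tsupport_subset hx'), zero_smul])]
  have i1 : Integrable (fun x => φ x • gradient ψ x) :=
    (hφ.contDiff.continuous.smul hψ.continuous_gradient).integrable_of_hasCompactSupport
      hφ.hasCompactSupport.smul_right
  have i2 : Integrable (fun x => ψ x • gradient φ x) :=
    (hψ.contDiff.continuous.smul hφ.continuous_gradient).integrable_of_hasCompactSupport
      hψ.hasCompactSupport.smul_right
  have i3 : Integrable (fun x => φ x * ψ x) :=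
    (hφ.contDiff.continuous.mul hψ.contDiff.continuous).integrable_of_hasCompactSupport
      hφ.hasCompactSupport.mul_right
  have e : ∀ (f : EuclideanSpace ℝ (Fin N) → ℝ) (x v : EuclideanSpace ℝ (Fin N)),
      inner ℝ v (gradient f x) = fderiv ℝ f x v := fun f x v => by
    rw [real_inner_comm]; exact InnerProductSpace.toDual_symm_apply
  refine ext_inner_left ℝ fun v => ?_
  rw [inner_neg_right, ← integral_inner i1, ← integral_inner i2]
  have j1 := i1.const_inner (𝕜 := ℝ) v
  have j2 := i2.const_inner (𝕜 := ℝ) v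
  simp only [inner_smul_right, e] at j1 j2 ⊢
  rw [integral_mul_fderiv_eq_neg_fderiv_mul_of_integrable (by simpa only [mul_comm] using j2) j1 i3
    (fun x _ => hφ.contDiff.differentiable (by simp) x)
    (fun x _ => hψ.contDiff.differentiable (by simp) x)]
  simp only [mul_comm]

/-- Every test function `φ`, with its classical gradient, is an element of `testSubmodule`. -/
theorem exists_mem_testSubmodule (h : Condition Ω p q μ) {φ : EuclideanSpace ℝ (Fin N) → ℝ}
    (hφ : IsTestFunction Ω φ) : ∃ w ∈ testSubmodule h,
      w.1.fst.1 =ᵐ[volume.restrict Ω] φ ∧ w.1.snd.1 =ᵐ[volume.restrict Ω] gradient φ := by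
  obtain ⟨C, hC⟩ := hφ.hasCompactSupport.exists_bound_of_continuous hφ.contDiff.continuous
  obtain ⟨D, hD⟩ := hφ.hasCompactSupport_gradient.exists_bound_of_continuous hφ.continuous_gradient
  have m1 : AEStronglyMeasurable φ (volume.restrict Ω) :=
    hφ.contDiff.continuous.aestronglyMeasurable
  have m2 : AEStronglyMeasurable (gradient φ) (volume.restrict Ω) :=
    hφ.continuous_gradient.aestronglyMeasurable
  have e1 := AEEqFun.coeFn_mk φ m1
  have e2 := AEEqFun.coeFn_mk (gradient φ) m2
  let u : LH h ℝ := ⟨AEEqFun.mk φ m1, (h.hasFiniteModular_of_bounded hC).congr e1.symm⟩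
  let g : LH h (EuclideanSpace ℝ (Fin N)) :=
    ⟨AEEqFun.mk (gradient φ) m2, (h.hasFiniteModular_of_bounded hD).congr e2.symm⟩
  have hw : WithLp.toLp 1 (u, g) ∈ W1H h := by
    intro ψ hψ
    have h1 : ∫ x in Ω, u.1 x • gradient ψ x = ∫ x in Ω, φ x • gradient ψ x :=
      integral_congr_ae (by filter_upwards [e1] with x hx; exact congrArg (· • gradient ψ x) hx)
    have h2 : ∫ x in Ω, ψ x • g.1 x = ∫ x in Ω, ψ x • gradient φ x :=
      integral_congr_ae (by filter_upwards [e2] with x hx; exact congrArg (ψ x • ·) hx)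
    exact h1.trans ((hφ.isWeakGradient ψ hψ).trans (congrArg Neg.neg h2.symm))
  exact ⟨⟨_, hw⟩, ⟨φ, hφ, e1⟩, e1, e2⟩

/-- `W₀^{1,H}(Ω)`, the closure of `C₀^∞(Ω)` in `W^{1,H}(Ω)`, with the norm of `W^{1,H}(Ω)`. -/
noncomputable def W01H (h : Condition Ω p q μ) : Submodule ℝ (W1H h) :=
  (testSubmodule h).topologicalClosure

/-- The weak gradient `∇u` of `u ∈ W₀^{1,H}(Ω)`. -/
noncomputable def grad {h : Condition Ω p q μ} (u : W01H h) :
    EuclideanSpace ℝ (Fin N) → EuclideanSpace ℝ (Fin N) :=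
  u.1.1.snd.1

/-! ## The energy and the double phase operator -/

/-- The integrand of the energy: `|∇u|^{p(x)} / p(x) + μ(x) |∇u|^{q(x)} / q(x)`. -/
noncomputable def energyIntegrand {h : Condition Ω p q μ} (u : W01H h)
    (x : EuclideanSpace ℝ (Fin N)) : ℝ :=
  ‖grad u x‖ ^ p x / p x + μ x * (‖grad u x‖ ^ q x / q x)

/-- The energy functional `I`. -/
noncomputable def energy (h : Condition Ω p q μ) (u : W01H h) : ℝ :=
  ∫ x in Ω, energyIntegrand u x

/-- The integrand of `⟨A(u), v⟩`:
`|∇u|^{p(x)-2} ∇u · ∇v + μ(x) |∇u|^{q(x)-2} ∇u · ∇v`. -/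
noncomputable def operatorIntegrand {h : Condition Ω p q μ} (u v : W01H h)
    (x : EuclideanSpace ℝ (Fin N)) : ℝ :=
  ‖grad u x‖ ^ (p x - 2) * inner ℝ (grad u x) (grad v x) +
    μ x * (‖grad u x‖ ^ (q x - 2) * inner ℝ (grad u x) (grad v x))

/-- `A : W₀^{1,H}(Ω) → W₀^{1,H}(Ω)*` is the double phase operator: each pairing `⟨A(u), v⟩` is
the integral of the (integrable) function `operatorIntegrand u v`. This determines `A`. -/
def IsDoublePhaseOperator (h : Condition Ω p q μ) (A : W01H h → StrongDual ℝ (W01H h)) : Prop :=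
  ∀ u v, IntegrableOn (operatorIntegrand u v) Ω ∧ A u v = ∫ x in Ω, operatorIntegrand u v x

end Sobolev

end DoublePhase

/-! The energy is convex, and its derivative can be found from that without differentiating under
the integral. Young's inequality makes `|ξ|^{e-2} ξ` a subgradient of `|ξ|^e / e`
(`rpow_mul_inner_sub_le`); integrating, `⟨A(u), w - u⟩ ≤ I(w) - I(u)` for all `u`, `w`. Together
with the same inequality with `u` and `w` exchanged, `0 ≤ I(w) - I(u) - ⟨A(u), w - u⟩ ≤ ⟨A(w) -
A(u), w - u⟩ ≤ ‖A(w) - A(u)‖ ‖w - u‖`. So norm continuity of `A` yields at once `I' = A` and the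
`C¹` property (`hasFDerivAt_of_subgradient`).

Continuity of `A` rests on a pointwise estimate: for each `ε` there is `C` with `||θ|^{e-2} θ -
|ξ|^{e-2} ξ| ≤ ε |ξ|^{e-1} + C |θ - ξ|^{e-1}` for all exponents `1 < e ≤ b`
(`exists_norm_rpow_smul_sub_le`). Being uniform in `e`, it holds with the same constants for `p(x)`
and for `q(x)`, and the latter case may be multiplied by `μ(x)`. Let `‖w - u‖ < r ≤ 1` and let `v`
lie in the open unit ball. Then `(w - u) / r` lies there too, and on that ball the modular of the
gradient is at most `1`. Testing against `∇v` with `s^{e-1} t ≤ s^e + t^e` and integrating gives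
`‖A(w) - A(u)‖ ≤ ε (ρ(∇u) + 1) + 2 C r^{a-1}`, where `a > 1` bounds the exponents from below.
Finiteness of `ρ(∇u)` is the `Δ₂` property. Only the field `∇u` enters, so the argument is run for
any linear contraction into `L^H`. -/

namespace DoublePhase

/-! ### Inequalities for `|ξ|^{e-2} ξ`, uniform in the exponent -/

section Pointwise

variable {F : Type*} [NormedAddCommGroup F] [InnerProductSpace ℝ F]

theorem norm_rpow_sub_two_smul {e : ℝ} (he : 1 < e) (ξ : F) :
    ‖‖ξ‖ ^ (e - 2) • ξ‖ = ‖ξ‖ ^ (e - 1) := by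
  rcases eq_or_ne ξ 0 with rfl | hξ
  -- At the origin the weight has only a conventional value, as `e - 2` may be negative or zero. The
  -- vector factor annihilates it, and `1 < e` makes the right side vanish.
  · simp [Real.zero_rpow (by linarith : e - 1 ≠ 0)]
  · have hpos : 0 < ‖ξ‖ := norm_pos_iff.2 hξ
    rw [norm_smul, Real.norm_of_nonneg (by positivity), ← Real.rpow_add_one hpos.ne']
    ring_nf

/-- Replacing the smaller of `s`, `t` by the larger bounds the product by `max(s, t)^e`. This crude
Young inequality has constants independent of `e`. -/
theorem rpow_sub_one_mul_le_add {e s t : ℝ} (he : 1 < e) (hs : 0 ≤ s) (ht : 0 ≤ t) :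
    s ^ (e - 1) * t ≤ s ^ e + t ^ e := by
  have key : ∀ r : ℝ, 0 ≤ r → r ^ (e - 1) * r = r ^ e := fun r hr => by
    rw [← Real.rpow_add_one' hr (by linarith), sub_add_cancel]
  rcases le_total s t with hst | hst
  · calc s ^ (e - 1) * t ≤ t ^ (e - 1) * t := by gcongr
      _ = t ^ e := key t ht
      _ ≤ s ^ e + t ^ e := le_add_of_nonneg_left (by positivity)
  · calc s ^ (e - 1) * t ≤ s ^ (e - 1) * s := by gcongr
      _ = s ^ e := key s hs
      _ ≤ s ^ e + t ^ e := le_add_of_nonneg_right (by positivity)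

/-- For `0 ≤ k ≤ b`, the distance of `s ^ k` from `1` is at most that of `s ^ b`. -/
theorem abs_rpow_sub_one_le {s k b : ℝ} (hs : 0 < s) (hk : 0 ≤ k) (hkb : k ≤ b) :
    |s ^ k - 1| ≤ |s ^ b - 1| := by
  rcases le_total 1 s with h1 | h1
  · have h2 := Real.rpow_le_rpow_of_exponent_le h1 hkb
    have h3 := Real.one_le_rpow h1 hk
    rw [abs_of_nonneg (by linarith), abs_of_nonneg (by linarith)]
    linarith
  · have h2 := Real.rpow_le_rpow_of_exponent_ge hs h1 hkb
    have h3 := Real.rpow_le_one hs.le h1 hk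
    rw [abs_of_nonpos (by linarith), abs_of_nonpos (by linarith)]
    linarith

/-- The regime where `θ` is close to `ξ` relative to `|ξ|`. The ratio `s = |θ| / |ξ|` is then within
`δ` of `1`, and a modulus `c` for the single power `s^b` controls all smaller exponents at once. -/
theorem norm_rpow_smul_sub_le_of_norm_sub_le {e b δ : ℝ} (he : 1 < e) (heb : e ≤ b)
    (hδ1 : δ < 1) {ξ θ : F} (h : ‖θ - ξ‖ ≤ δ * ‖ξ‖) {c : ℝ}
    (hc : ∀ s : ℝ, |s - 1| ≤ δ → |s ^ b - 1| ≤ c) :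
    ‖‖θ‖ ^ (e - 2) • θ - ‖ξ‖ ^ (e - 2) • ξ‖ ≤ (2 * δ + c) * ‖ξ‖ ^ (e - 1) := by
  rcases eq_or_ne ξ 0 with rfl | hξ
  · have : θ = 0 := by simpa using h
    subst this
    simp [Real.zero_rpow (by linarith : e - 1 ≠ 0)]
  have hξ0 : 0 < ‖ξ‖ := norm_pos_iff.2 hξ
  set s := ‖θ‖ / ‖ξ‖ with hs
  have hθs : ‖θ‖ = s * ‖ξ‖ := by rw [hs]; field_simp
  have hs1 : |s - 1| ≤ δ := by
    have h1 := (abs_norm_sub_norm_le θ ξ).trans h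
    have h2 : ‖θ‖ - ‖ξ‖ = (s - 1) * ‖ξ‖ := by rw [hθs]; ring
    rw [h2, abs_mul, abs_norm] at h1
    exact le_of_mul_le_mul_right h1 hξ0
  have hs0 : 0 < s := by linarith [(abs_le.1 hs1).1]
  have hd : ‖θ‖ ^ (e - 2) • θ - ‖ξ‖ ^ (e - 2) • ξ =
      ‖ξ‖ ^ (e - 2) • ((s ^ (e - 2) - 1) • θ + (θ - ξ)) := by
    rw [hθs, Real.mul_rpow hs0.le hξ0.le]
    module
  have hb : ‖(s ^ (e - 2) - 1) • θ‖ ≤ (c + δ) * ‖ξ‖ := by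
    -- The exponent `e - 2` may be negative; absorbing the factor `|θ| = s |ξ|` turns it into `e -
    -- 1`, which lies in `[0, b]`.
    have h1 : ‖(s ^ (e - 2) - 1) • θ‖ = |(s ^ (e - 1) - 1) - (s - 1)| * ‖ξ‖ := by
      have h3 : s ^ (e - 1) = s ^ (e - 2) * s := by
        rw [← Real.rpow_add_one hs0.ne']; ring_nf
      rw [norm_smul, Real.norm_eq_abs, hθs, h3, ← mul_assoc]
      congr 1
      nth_rewrite 2 [← abs_of_pos hs0]
      rw [← abs_mul]
      ring_nf
    rw [h1]
    gcongr
    refine (abs_sub _ _).trans (add_le_add ?_ hs1)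
    exact (abs_rpow_sub_one_le hs0 (by linarith) (by linarith)).trans (hc s hs1)
  have he1 : ‖ξ‖ ^ (e - 1) = ‖ξ‖ ^ (e - 2) * ‖ξ‖ := by
    rw [← Real.rpow_add_one hξ0.ne']; ring_nf
  rw [hd, norm_smul, Real.norm_of_nonneg (by positivity), he1]
  calc ‖ξ‖ ^ (e - 2) * ‖(s ^ (e - 2) - 1) • θ + (θ - ξ)‖
      ≤ ‖ξ‖ ^ (e - 2) * ((c + δ) * ‖ξ‖ + δ * ‖ξ‖) := by
        gcongr
        exact (norm_add_le _ _).trans (add_le_add hb h)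
    _ = (2 * δ + c) * (‖ξ‖ ^ (e - 2) * ‖ξ‖) := by ring

/-- The complementary regime needs no cancellation: both `|ξ|` and `|θ|` are at most `(1 + δ⁻¹) |θ -
ξ|`. Since the base `1 + δ⁻¹` is at least `1`, its exponent can be raised to `b`. -/
theorem norm_rpow_smul_sub_le_of_le_norm_sub {e b δ : ℝ} (he : 1 < e) (heb : e ≤ b)
    (hδ : 0 < δ) {ξ θ : F} (h : δ * ‖ξ‖ ≤ ‖θ - ξ‖) :
    ‖‖θ‖ ^ (e - 2) • θ - ‖ξ‖ ^ (e - 2) • ξ‖ ≤ 2 * (1 + δ⁻¹) ^ b * ‖θ - ξ‖ ^ (e - 1) := by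
  have hδ' : 0 < δ⁻¹ := inv_pos.2 hδ
  have h1 : ‖ξ‖ ≤ δ⁻¹ * ‖θ - ξ‖ := by rwa [← div_eq_inv_mul, le_div_iff₀' hδ]
  have hξ : ‖ξ‖ ≤ (1 + δ⁻¹) * ‖θ - ξ‖ := by nlinarith [norm_nonneg (θ - ξ)]
  have hθ : ‖θ‖ ≤ (1 + δ⁻¹) * ‖θ - ξ‖ := by
    have : ‖θ‖ ≤ ‖θ - ξ‖ + ‖ξ‖ := by simpa using norm_add_le (θ - ξ) ξ
    linarith
  have key : ∀ ζ : F, ‖ζ‖ ≤ (1 + δ⁻¹) * ‖θ - ξ‖ →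
      ‖‖ζ‖ ^ (e - 2) • ζ‖ ≤ (1 + δ⁻¹) ^ b * ‖θ - ξ‖ ^ (e - 1) := fun ζ hζ => by
    rw [norm_rpow_sub_two_smul he]
    calc ‖ζ‖ ^ (e - 1) ≤ ((1 + δ⁻¹) * ‖θ - ξ‖) ^ (e - 1) := by gcongr
      _ = (1 + δ⁻¹) ^ (e - 1) * ‖θ - ξ‖ ^ (e - 1) := Real.mul_rpow (by positivity) (by positivity)
      _ ≤ (1 + δ⁻¹) ^ b * ‖θ - ξ‖ ^ (e - 1) := by
        gcongr
        · linarith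
        · linarith
  calc _ ≤ _ := norm_sub_le _ _
    _ ≤ _ := add_le_add (key θ hθ) (key ξ hξ)
    _ = _ := by ring

/-- The maps `ξ ↦ |ξ|^{e-2} ξ` are continuous in a homogeneous sense, uniformly for exponents
`1 < e ≤ b`. -/
theorem exists_norm_rpow_smul_sub_le (F : Type*) [NormedAddCommGroup F] [InnerProductSpace ℝ F]
    (b : ℝ) {ε : ℝ} (hε : 0 < ε) : ∃ C : ℝ, 0 ≤ C ∧ ∀ e : ℝ, 1 < e → e ≤ b → ∀ ξ θ : F,
      ‖‖θ‖ ^ (e - 2) • θ - ‖ξ‖ ^ (e - 2) • ξ‖ ≤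
        ε * ‖ξ‖ ^ (e - 1) + C * ‖θ - ξ‖ ^ (e - 1) := by
  have hcont : ContinuousAt (fun s : ℝ => s ^ b) 1 :=
    Real.continuousAt_rpow_const _ _ (Or.inl one_ne_zero)
  obtain ⟨d, hd, hd'⟩ := Metric.continuousAt_iff.1 hcont (ε / 2) (by positivity)
  -- `d / 2` puts `s^b` within `ε / 2` of `1`, `1 / 2` keeps `δ < 1`, and `ε / 4` makes `2 δ + ε / 2
  -- ≤ ε`.
  set δ := min (d / 2) (min (1 / 2) (ε / 4)) with hδdef
  have hδ : 0 < δ := by positivity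
  have hδ1 : δ < 1 := ((min_le_right _ _).trans (min_le_left _ _)).trans_lt (by norm_num)
  have hδε : δ ≤ ε / 4 := (min_le_right _ _).trans (min_le_right _ _)
  have hδd : δ < d := (min_le_left _ _).trans_lt (by linarith)
  refine ⟨2 * (1 + δ⁻¹) ^ b, by positivity, fun e he heb ξ θ => ?_⟩
  rcases le_total ‖θ - ξ‖ (δ * ‖ξ‖) with h | h
  · refine (norm_rpow_smul_sub_le_of_norm_sub_le he heb hδ1 h (c := ε / 2) fun s hs => ?_).trans
      (le_add_of_le_of_nonneg ?_ (by positivity))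
    · have := hd' (x := s) (by rw [Real.dist_eq]; linarith)
      rw [Real.dist_eq, Real.one_rpow] at this
      exact this.le
    · gcongr
      linarith
  · exact (norm_rpow_smul_sub_le_of_le_norm_sub he heb hδ h).trans
      (le_add_of_nonneg_left (by positivity))

/-- The subgradient inequality for `ξ ↦ |ξ|^e / e`. -/
theorem rpow_mul_inner_sub_le {e : ℝ} (he : 1 < e) (ξ θ : F) :
    ‖ξ‖ ^ (e - 2) * inner ℝ ξ (θ - ξ) ≤ ‖θ‖ ^ e / e - ‖ξ‖ ^ e / e := by
  have hconj := Real.HolderConjugate.conjExponent he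
  have h1 : ‖ξ‖ ^ (e - 2) * inner ℝ ξ θ ≤ ‖ξ‖ ^ (e - 1) * ‖θ‖ := by
    rw [← real_inner_smul_left, ← norm_rpow_sub_two_smul he]
    exact real_inner_le_norm _ _
  -- With `e'` the conjugate exponent, `(e - 1) e' = e`, so the second Young term is `|ξ|^e / e' =
  -- |ξ|^e - |ξ|^e / e`; its `|ξ|^e` cancels the contribution of `inner ξ ξ`.
  have h2 := Real.young_inequality_of_nonneg (norm_nonneg θ)
    (Real.rpow_nonneg (norm_nonneg ξ) (e - 1)) hconj
  rw [← Real.rpow_mul (norm_nonneg _), hconj.sub_one_mul_conj] at h2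
  have h3 : ‖ξ‖ ^ (e - 2) * inner ℝ ξ ξ = ‖ξ‖ ^ e := by
    rw [real_inner_self_eq_norm_mul_norm, ← mul_assoc]
    rcases eq_or_ne ‖ξ‖ 0 with h0 | h0
    · simp [h0, Real.zero_rpow (by linarith : e ≠ 0)]
    · rw [← Real.rpow_add_one h0, ← Real.rpow_add_one h0]
      ring_nf
  have h4 : ‖ξ‖ ^ e / e.conjExponent = ‖ξ‖ ^ e - ‖ξ‖ ^ e / e := by
    have := hconj.inv_add_inv_eq_one
    rw [div_eq_mul_inv, div_eq_mul_inv, eq_sub_of_add_eq' this]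
    ring
  rw [inner_sub_right, mul_sub, h3]
  linarith

/-- The difference of the monotone maps, tested against a vector. -/
theorem abs_inner_rpow_smul_sub_le {a e ε C r : ℝ} (ha : a ≤ e) (he : 1 < e) (hε : 0 ≤ ε)
    (hC : 0 ≤ C) (hr : 0 < r) (hr1 : r ≤ 1) {ξ θ : F} (ζ : F)
    (h : ‖‖θ‖ ^ (e - 2) • θ - ‖ξ‖ ^ (e - 2) • ξ‖ ≤
      ε * ‖ξ‖ ^ (e - 1) + C * ‖θ - ξ‖ ^ (e - 1)) :
    |‖θ‖ ^ (e - 2) * inner ℝ θ ζ - ‖ξ‖ ^ (e - 2) * inner ℝ ξ ζ| ≤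
      ε * (‖ξ‖ ^ e + ‖ζ‖ ^ e) + C * r ^ (a - 1) * (‖r⁻¹ • (θ - ξ)‖ ^ e + ‖ζ‖ ^ e) := by
  rw [← real_inner_smul_left, ← real_inner_smul_left, ← inner_sub_left]
  -- Rescaling the increment by `r` extracts `r^{e-1} ≤ r^{a-1}`, a rate of decay common to all
  -- exponents `e ≥ a`.
  have h1 : ‖θ - ξ‖ = r * ‖r⁻¹ • (θ - ξ)‖ := by
    rw [norm_smul, Real.norm_of_nonneg (by positivity), mul_inv_cancel_left₀ hr.ne']
  rw [h1, Real.mul_rpow hr.le (norm_nonneg _)] at h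
  have h2 : r ^ (e - 1) ≤ r ^ (a - 1) := Real.rpow_le_rpow_of_exponent_ge hr hr1 (by linarith)
  calc _ ≤ _ := abs_real_inner_le_norm _ _
    _ ≤ (ε * ‖ξ‖ ^ (e - 1) + C * (r ^ (e - 1) * ‖r⁻¹ • (θ - ξ)‖ ^ (e - 1))) * ‖ζ‖ := by gcongr
    _ = ε * (‖ξ‖ ^ (e - 1) * ‖ζ‖) +
        C * r ^ (e - 1) * (‖r⁻¹ • (θ - ξ)‖ ^ (e - 1) * ‖ζ‖) := by ring
    _ ≤ _ := by
      gcongr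
      · exact rpow_sub_one_mul_le_add he (norm_nonneg _) (norm_nonneg _)
      · exact rpow_sub_one_mul_le_add he (norm_nonneg _) (norm_nonneg _)

theorem abs_rpow_mul_inner_le {e : ℝ} (he : 1 < e) (ξ ζ : F) :
    |‖ξ‖ ^ (e - 2) * inner ℝ ξ ζ| ≤ ‖ξ‖ ^ e + ‖ζ‖ ^ e := by
  rw [← real_inner_smul_left]
  refine (abs_real_inner_le_norm _ _).trans ?_
  rw [norm_rpow_sub_two_smul he]
  exact rpow_sub_one_mul_le_add he (norm_nonneg _) (norm_nonneg _)

end Pointwise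

/-! ### Modular and Luxemburg norm -/

section Phase

variable {N : ℕ} {Ω : Set (EuclideanSpace ℝ (Fin N))} {p q μ : EuclideanSpace ℝ (Fin N) → ℝ}
  {F : Type*} [NormedAddCommGroup F] [NormedSpace ℝ F]

/-- By compactness of `closure Ω`, `a` can be the minimum of `p` and `b` the maximum of `q`; the
mixed bounds follow from `p < q`. -/
theorem Condition.exists_exponent_bounds (h : Condition Ω p q μ) :
    ∃ a b : ℝ, 1 < a ∧ ∀ x ∈ Ω, a ≤ p x ∧ a ≤ q x ∧ p x ≤ b ∧ q x ≤ b := by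
  have hc : IsCompact (closure Ω) := h.isBounded.isCompact_closure
  have hne : (closure Ω).Nonempty := h.isConnected.nonempty.closure
  obtain ⟨y, hy, hy'⟩ := hc.exists_isMinOn hne h.continuousOn_p
  obtain ⟨z, hz, hz'⟩ := hc.exists_isMaxOn hne h.continuousOn_q
  refine ⟨p y, q z, h.one_lt_p y hy, fun x hx => ?_⟩
  have hx' := subset_closure hx
  have h1 : p y ≤ p x := hy' hx'
  have h2 : q x ≤ q z := hz' hx'
  have h3 := h.p_lt_q x hx'
  exact ⟨h1, by linarith, by linarith, h2⟩

theorem Condition.integrableOn_phaseFun_of_modular_lt_top (h : Condition Ω p q μ)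
    {u : EuclideanSpace ℝ (Fin N) → F} (hu : AEStronglyMeasurable u (volume.restrict Ω))
    (hf : modular Ω p q μ u < ⊤) : IntegrableOn (fun x => phaseFun p q μ x ‖u x‖) Ω := by
  refine ⟨(h.aemeasurable_phaseFun hu).aestronglyMeasurable, ?_⟩
  rw [hasFiniteIntegral_iff_ofReal]
  · exact hf
  · filter_upwards [h.ae_bounds] with x hx using Condition.phaseFun_nonneg hx (norm_nonneg _)

/-- The modular is finite on all of `L^H(Ω)`, by the `Δ₂` condition. -/
theorem Condition.integrableOn_phaseFun (h : Condition Ω p q μ)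
    {u : EuclideanSpace ℝ (Fin N) → F} (hum : AEStronglyMeasurable u (volume.restrict Ω))
    (hu : HasFiniteModular Ω p q μ u) : IntegrableOn (fun x => phaseFun p q μ x ‖u x‖) Ω := by
  obtain ⟨α, hα, hf⟩ := hu
  obtain ⟨a, b, -, hab⟩ := h.exists_exponent_bounds
  have hI := h.integrableOn_phaseFun_of_modular_lt_top (hum.const_smul α) hf
  -- The maximum with `1` gives a base whose powers increase with the exponent, so that `b` serves
  -- for both `p(x)` and `q(x)`.
  refine Integrable.mono' (hI.const_mul (max 1 α⁻¹ ^ b))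
    (h.aemeasurable_phaseFun hum).aestronglyMeasurable ?_
  filter_upwards [h.ae_bounds, ae_restrict_mem h.isOpen.measurableSet] with x hx hxΩ
  rw [Real.norm_of_nonneg (Condition.phaseFun_nonneg hx (norm_nonneg _))]
  obtain ⟨-, -, hpb, hqb⟩ := hab x hxΩ
  have key : ∀ e : ℝ, 1 < e → e ≤ b → ‖u x‖ ^ e ≤ max 1 α⁻¹ ^ b * ‖α • u x‖ ^ e := by
    intro e he heb
    have h1 : ‖u x‖ = α⁻¹ * ‖α • u x‖ := by
      rw [norm_smul, Real.norm_of_nonneg hα.le, inv_mul_cancel_left₀ hα.ne']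
    rw [h1, Real.mul_rpow (by positivity) (norm_nonneg _)]
    gcongr
    calc α⁻¹ ^ e ≤ max 1 α⁻¹ ^ e := by gcongr; exact le_max_right _ _
      _ ≤ max 1 α⁻¹ ^ b := Real.rpow_le_rpow_of_exponent_le (le_max_left _ _) heb
  have h1 := key _ hx.1 hpb
  have h2 := mul_le_mul_of_nonneg_left (key _ hx.2.1 hqb) hx.2.2
  simp only [phaseFun, Pi.smul_apply]
  linarith

/-- Some `τ < 1` is admissible in the infimum, and convexity with `ρ(0) = 0` gives `ρ(u) ≤ τ ρ(u /
τ) ≤ 1`. The strict inequality avoids asking whether the infimum is attained. -/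
theorem Condition.modular_le_one_of_luxNorm_lt_one (h : Condition Ω p q μ)
    {u : EuclideanSpace ℝ (Fin N) → F} (hu : HasFiniteModular Ω p q μ u)
    (h1 : luxNorm Ω p q μ u < 1) : modular Ω p q μ u ≤ 1 := by
  obtain ⟨τ, ⟨hτ, hτ1⟩, hτ2⟩ := exists_lt_of_csInf_lt (h.luxNorm_set_nonempty hu) h1
  have h2 := h.modular_smul_le (fun x => τ⁻¹ • u x) hτ.le hτ2.le
  simp only [smul_smul, mul_inv_cancel₀ hτ.ne', one_smul] at h2
  calc modular Ω p q μ u ≤ ENNReal.ofReal τ * modular Ω p q μ (fun x => τ⁻¹ • u x) := h2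
    _ ≤ 1 * 1 := by
      gcongr
      exact ENNReal.ofReal_le_one.2 hτ2.le
    _ = 1 := one_mul 1

theorem Condition.integral_phaseFun_le_one (h : Condition Ω p q μ)
    {u : EuclideanSpace ℝ (Fin N) → F} (hum : AEStronglyMeasurable u (volume.restrict Ω))
    (hu : HasFiniteModular Ω p q μ u) (h1 : luxNorm Ω p q μ u < 1) :
    ∫ x in Ω, phaseFun p q μ x ‖u x‖ ≤ 1 := by
  rw [integral_eq_lintegral_of_nonneg_ae]
  · exact ENNReal.toReal_le_of_le_ofReal zero_le_one
      (by simpa [modular] using h.modular_le_one_of_luxNorm_lt_one hu h1)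
  · filter_upwards [h.ae_bounds] with x hx using Condition.phaseFun_nonneg hx (norm_nonneg _)
  · exact (h.aemeasurable_phaseFun hum).aestronglyMeasurable

theorem Condition.integral_phaseFun_nonneg (h : Condition Ω p q μ)
    (u : EuclideanSpace ℝ (Fin N) → F) : 0 ≤ ∫ x in Ω, phaseFun p q μ x ‖u x‖ := by
  refine integral_nonneg_of_ae ?_
  filter_upwards [h.ae_bounds] with x hx using Condition.phaseFun_nonneg hx (norm_nonneg _)

end Phase

/-! ### Energy density and flux pairing -/

section Densities

variable {N : ℕ} {Ω : Set (EuclideanSpace ℝ (Fin N))} {p q μ : EuclideanSpace ℝ (Fin N) → ℝ}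
  {F : Type*} [NormedAddCommGroup F] [InnerProductSpace ℝ F]

variable (p q μ) in
/-- The energy density of a vector field `g`. -/
noncomputable def energyDensity (g : EuclideanSpace ℝ (Fin N) → F)
    (x : EuclideanSpace ℝ (Fin N)) : ℝ :=
  ‖g x‖ ^ p x / p x + μ x * (‖g x‖ ^ q x / q x)

variable (p q μ) in
/-- The pairing of the double phase flux of `f` with `g`. -/
noncomputable def fluxPairing (f g : EuclideanSpace ℝ (Fin N) → F)
    (x : EuclideanSpace ℝ (Fin N)) : ℝ :=
  ‖f x‖ ^ (p x - 2) * inner ℝ (f x) (g x) +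
    μ x * (‖f x‖ ^ (q x - 2) * inner ℝ (f x) (g x))

theorem Condition.aemeasurable_exponents (h : Condition Ω p q μ) :
    AEMeasurable p (volume.restrict Ω) ∧ AEMeasurable q (volume.restrict Ω) ∧
      AEMeasurable μ (volume.restrict Ω) :=
  ⟨(h.continuousOn_p.mono subset_closure).aemeasurable h.isOpen.measurableSet,
    (h.continuousOn_q.mono subset_closure).aemeasurable h.isOpen.measurableSet,
    h.integrableOn_μ.aemeasurable⟩

theorem Condition.integrableOn_energyDensity (h : Condition Ω p q μ)
    {g : EuclideanSpace ℝ (Fin N) → F} (hgm : AEStronglyMeasurable g (volume.restrict Ω))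
    (hg : HasFiniteModular Ω p q μ g) : IntegrableOn (energyDensity p q μ g) Ω := by
  obtain ⟨hp, hq, hμ⟩ := h.aemeasurable_exponents
  have hn : AEMeasurable (fun x => ‖g x‖) (volume.restrict Ω) := hgm.norm.aemeasurable
  refine Integrable.mono' (h.integrableOn_phaseFun hgm hg)
    (((hn.pow hp).div hp).add (hμ.mul ((hn.pow hq).div hq))).aestronglyMeasurable ?_
  filter_upwards [h.ae_bounds] with x ⟨h1, h2, h3⟩
  have hp0 := Real.rpow_nonneg (norm_nonneg (g x)) (p x)
  have hq0 := Real.rpow_nonneg (norm_nonneg (g x)) (q x)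
  rw [energyDensity, phaseFun, Real.norm_of_nonneg (by positivity)]
  gcongr
  · exact div_le_self hp0 h1.le
  · exact div_le_self hq0 h2.le

/-- This bound plays the part of Hölder's inequality: it yields integrability of the pairing and,
for `g` of modular at most `1`, boundedness of the functional. -/
theorem Condition.abs_fluxPairing_le (h : Condition Ω p q μ)
    (f g : EuclideanSpace ℝ (Fin N) → F) : ∀ᵐ x ∂(volume.restrict Ω),
    |fluxPairing p q μ f g x| ≤ phaseFun p q μ x ‖f x‖ + phaseFun p q μ x ‖g x‖ := by
  filter_upwards [h.ae_bounds] with x ⟨h1, h2, h3⟩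
  have e1 := abs_rpow_mul_inner_le h1 (f x) (g x)
  have e2 := mul_le_mul_of_nonneg_left (abs_rpow_mul_inner_le h2 (f x) (g x)) h3
  have e3 := abs_add_le (‖f x‖ ^ (p x - 2) * inner ℝ (f x) (g x))
    (μ x * (‖f x‖ ^ (q x - 2) * inner ℝ (f x) (g x)))
  rw [abs_mul (μ x), abs_of_nonneg h3] at e3
  simp only [fluxPairing, phaseFun]
  linarith

theorem Condition.integrableOn_fluxPairing (h : Condition Ω p q μ)
    {f g : EuclideanSpace ℝ (Fin N) → F} (hfm : AEStronglyMeasurable f (volume.restrict Ω))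
    (hf : HasFiniteModular Ω p q μ f) (hgm : AEStronglyMeasurable g (volume.restrict Ω))
    (hg : HasFiniteModular Ω p q μ g) : IntegrableOn (fluxPairing p q μ f g) Ω := by
  obtain ⟨hp, hq, hμ⟩ := h.aemeasurable_exponents
  have hn : AEMeasurable (fun x => ‖f x‖) (volume.restrict Ω) := hfm.norm.aemeasurable
  have hi : AEMeasurable (fun x => inner ℝ (f x) (g x)) (volume.restrict Ω) :=
    (hfm.inner hgm).aemeasurable
  exact Integrable.mono' ((h.integrableOn_phaseFun hfm hf).add (h.integrableOn_phaseFun hgm hg))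
    (((hn.pow (hp.sub_const 2)).mul hi).add
      (hμ.mul ((hn.pow (hq.sub_const 2)).mul hi))).aestronglyMeasurable
    (h.abs_fluxPairing_le f g)

/-- The scalar estimate is used at `p(x)` and, multiplied by `μ(x) ≥ 0`, at `q(x)`. The constants
agree, so the powers recombine into `phaseFun`. -/
theorem Condition.abs_fluxPairing_sub_le (h : Condition Ω p q μ) {a b ε C r : ℝ}
    (hab : ∀ x ∈ Ω, a ≤ p x ∧ a ≤ q x ∧ p x ≤ b ∧ q x ≤ b) (hε : 0 ≤ ε) (hC : 0 ≤ C)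
    (hr : 0 < r) (hr1 : r ≤ 1)
    (hF : ∀ e : ℝ, 1 < e → e ≤ b → ∀ ξ θ : F,
      ‖‖θ‖ ^ (e - 2) • θ - ‖ξ‖ ^ (e - 2) • ξ‖ ≤ ε * ‖ξ‖ ^ (e - 1) + C * ‖θ - ξ‖ ^ (e - 1))
    (f f' g : EuclideanSpace ℝ (Fin N) → F) : ∀ᵐ x ∂(volume.restrict Ω),
      |fluxPairing p q μ f' g x - fluxPairing p q μ f g x| ≤
        ε * (phaseFun p q μ x ‖f x‖ + phaseFun p q μ x ‖g x‖) +
        C * r ^ (a - 1) *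
          (phaseFun p q μ x ‖r⁻¹ • (f' x - f x)‖ + phaseFun p q μ x ‖g x‖) := by
  filter_upwards [h.ae_bounds, ae_restrict_mem h.isOpen.measurableSet] with x ⟨h1, h2, h3⟩ hx
  obtain ⟨hpa, hqa, hpb, hqb⟩ := hab x hx
  have e1 := abs_inner_rpow_smul_sub_le hpa h1 hε hC hr hr1 (g x) (hF _ h1 hpb (f x) (f' x))
  have e2 := mul_le_mul_of_nonneg_left
    (abs_inner_rpow_smul_sub_le hqa h2 hε hC hr hr1 (g x) (hF _ h2 hqb (f x) (f' x))) h3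
  nth_rewrite 1 [← abs_of_nonneg h3] at e2
  rw [← abs_mul] at e2
  have e3 := (abs_add_le _ _).trans (add_le_add e1 e2)
  simp only [fluxPairing, phaseFun]
  refine le_trans (le_of_eq ?_) (e3.trans (le_of_eq ?_))
  · congr 1
    ring
  · ring

theorem Condition.fluxPairing_sub_le (h : Condition Ω p q μ)
    (f g : EuclideanSpace ℝ (Fin N) → F) : ∀ᵐ x ∂(volume.restrict Ω),
      fluxPairing p q μ f (fun y => g y - f y) x ≤
        energyDensity p q μ g x - energyDensity p q μ f x := by
  filter_upwards [h.ae_bounds] with x ⟨h1, h2, h3⟩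
  have e1 := rpow_mul_inner_sub_le h1 (f x) (g x)
  have e2 := mul_le_mul_of_nonneg_left (rpow_mul_inner_sub_le h2 (f x) (g x)) h3
  simp only [fluxPairing, energyDensity]
  linarith

end Densities

/-! ### Linear bounds and differentiability from subgradients -/

section Subgradient

/-- A linear functional that is bounded by `C` on the unit ball is bounded by `C ‖v‖`. -/
theorem abs_le_mul_norm_of_ball {E : Type*} [SeminormedAddCommGroup E] [NormedSpace ℝ E]
    (f : E →ₗ[ℝ] ℝ) {C : ℝ} (hC : 0 ≤ C) (hf : ∀ v, ‖v‖ < 1 → |f v| ≤ C) (v : E) :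
    |f v| ≤ C * ‖v‖ := by
  refine le_of_forall_pos_le_add fun ε hε => ?_
  -- Dividing by slightly more than `‖v‖` lands in the open ball and covers `‖v‖ = 0`; the excess
  -- costs `C ε / (C + 1) ≤ ε`.
  set c := ‖v‖ + ε / (C + 1) with hc
  have hc0 : 0 < c := by positivity
  have h1 : ‖c⁻¹ • v‖ < 1 := by
    rw [norm_smul, Real.norm_of_nonneg (by positivity), inv_mul_lt_iff₀ hc0, mul_one, hc]
    exact lt_add_of_pos_right _ (by positivity)
  have h2 := hf _ h1
  rw [map_smul, smul_eq_mul, abs_mul, abs_of_pos (inv_pos.2 hc0), inv_mul_le_iff₀ hc0] at h2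
  have h3 : C * (ε / (C + 1)) ≤ ε := by
    rw [← mul_div_assoc, div_le_iff₀ (by positivity)]
    linarith
  calc |f v| ≤ c * C := h2
    _ = C * ‖v‖ + C * (ε / (C + 1)) := by rw [hc]; ring
    _ ≤ C * ‖v‖ + ε := by gcongr

/-- A function with a continuous selection of subgradients is differentiable. -/
theorem hasFDerivAt_of_subgradient {E : Type*} [NormedAddCommGroup E] [NormedSpace ℝ E]
    {f : E → ℝ} {A : E → StrongDual ℝ E} {u : E} (hA : ContinuousAt A u)
    (hf : ∀ u w, A u (w - u) ≤ f w - f u) : HasFDerivAt f (A u) u := by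
  rw [hasFDerivAt_iff_isLittleO, Asymptotics.isLittleO_iff]
  intro c hc
  filter_upwards [Metric.continuousAt_iff'.1 hA c hc] with w hw
  rw [dist_eq_norm] at hw
  -- The inequalities at `u` and at `w` enclose the remainder `f w - f u - A u (w - u)` between `0`
  -- and `(A w - A u) (w - u)`.
  have h1 := hf u w
  have h2 := hf w u
  have h3 : A w (u - w) = -A w (w - u) := by rw [← map_neg, neg_sub]
  have h4 : (A w - A u) (w - u) ≤ c * ‖w - u‖ :=
    (le_abs_self _).trans (((A w - A u).le_opNorm _).trans (by gcongr))
  rw [sub_apply] at h4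
  rw [Real.norm_of_nonneg (by linarith)]
  linarith

end Subgradient

/-! ### Operator and energy along a linear contraction into `L^H` -/

section Operator

variable {N : ℕ} {Ω : Set (EuclideanSpace ℝ (Fin N))} {p q μ : EuclideanSpace ℝ (Fin N) → ℝ}
  {F : Type*} [NormedAddCommGroup F] [InnerProductSpace ℝ F]
  {V : Type*} [NormedAddCommGroup V] [NormedSpace ℝ V]

/-- Linear maps from a normed space `V` to the classes of measurable functions `Ω → F`. -/
abbrev FieldMap (Ω : Set (EuclideanSpace ℝ (Fin N))) (F V : Type*) [NormedAddCommGroup F]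
    [InnerProductSpace ℝ F] [NormedAddCommGroup V] [NormedSpace ℝ V] : Type _ :=
  V →ₗ[ℝ] EuclideanSpace ℝ (Fin N) →ₘ[volume.restrict Ω] F

/-- `D` is a linear map of norm at most `1` from `V` into the Musielak-Orlicz space `L^H(Ω; F)`. -/
structure IsContractionIntoLH (h : Condition Ω p q μ)
    (D : FieldMap Ω F V) : Prop where
  hasFiniteModular : ∀ u, HasFiniteModular Ω p q μ (D u)
  luxNorm_le : ∀ u, luxNorm Ω p q μ (D u) ≤ ‖u‖

namespace IsContractionIntoLH

variable {h : Condition Ω p q μ} {D : FieldMap Ω F V}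

theorem coeFn_map_add (u v : V) : D (u + v) =ᵐ[volume.restrict Ω] fun x => D u x + D v x := by
  rw [map_add]
  exact AEEqFun.coeFn_add _ _

theorem coeFn_map_smul (c : ℝ) (u : V) : D (c • u) =ᵐ[volume.restrict Ω] fun x => c • D u x := by
  rw [map_smul]
  exact AEEqFun.coeFn_smul _ _

theorem coeFn_map_sub (u v : V) : D (u - v) =ᵐ[volume.restrict Ω] fun x => D u x - D v x := by
  rw [map_sub]
  exact AEEqFun.coeFn_sub _ _

theorem integrableOn_phaseFun (hD : IsContractionIntoLH h D) (u : V) :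
    IntegrableOn (fun x => phaseFun p q μ x ‖D u x‖) Ω :=
  h.integrableOn_phaseFun (D u).aestronglyMeasurable (hD.hasFiniteModular u)

theorem integral_phaseFun_le_one (hD : IsContractionIntoLH h D) {u : V} (hu : ‖u‖ < 1) :
    ∫ x in Ω, phaseFun p q μ x ‖D u x‖ ≤ 1 :=
  h.integral_phaseFun_le_one (D u).aestronglyMeasurable (hD.hasFiniteModular u)
    ((hD.luxNorm_le u).trans_lt hu)

theorem integrableOn_energyDensity (hD : IsContractionIntoLH h D) (u : V) :
    IntegrableOn (energyDensity p q μ (D u)) Ω :=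
  h.integrableOn_energyDensity (D u).aestronglyMeasurable (hD.hasFiniteModular u)

theorem integrableOn_fluxPairing (hD : IsContractionIntoLH h D) (u v : V) :
    IntegrableOn (fluxPairing p q μ (D u) (D v)) Ω :=
  h.integrableOn_fluxPairing (D u).aestronglyMeasurable (hD.hasFiniteModular u)
    (D v).aestronglyMeasurable (hD.hasFiniteModular v)

/-- `v ↦ ⟨A(u), v⟩` as a linear map. -/
noncomputable def pairing (hD : IsContractionIntoLH h D) (u : V) : V →ₗ[ℝ] ℝ where
  toFun v := ∫ x in Ω, fluxPairing p q μ (D u) (D v) x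
  map_add' v w := by
    rw [← integral_add (hD.integrableOn_fluxPairing u v) (hD.integrableOn_fluxPairing u w)]
    refine integral_congr_ae ?_
    filter_upwards [coeFn_map_add (D := D) v w] with x hx
    simp only [fluxPairing, hx, inner_add_right]
    ring
  map_smul' c v := by
    rw [RingHom.id_apply, smul_eq_mul, ← integral_const_mul]
    refine integral_congr_ae ?_
    filter_upwards [coeFn_map_smul (D := D) c v] with x hx
    simp only [fluxPairing, hx, inner_smul_right]
    ring

/-- For `‖w‖ < 1` the modular of `D w` is at most `1`, which is the summand `1` in the constant;
homogeneity extends the bound to all `v`. -/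
theorem abs_pairing_le (hD : IsContractionIntoLH h D) (u v : V) :
    |hD.pairing u v| ≤ ((∫ x in Ω, phaseFun p q μ x ‖D u x‖) + 1) * ‖v‖ := by
  refine abs_le_mul_norm_of_ball _ (add_nonneg (h.integral_phaseFun_nonneg _) zero_le_one)
    (fun w hw => ?_) v
  calc |hD.pairing u w| ≤ ∫ x in Ω, |fluxPairing p q μ (D u) (D w) x| :=
        abs_integral_le_integral_abs
    _ ≤ ∫ x in Ω, (phaseFun p q μ x ‖D u x‖ + phaseFun p q μ x ‖D w x‖) :=
      integral_mono_ae (hD.integrableOn_fluxPairing u w).abs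
        ((hD.integrableOn_phaseFun u).add (hD.integrableOn_phaseFun w))
        (h.abs_fluxPairing_le _ _)
    _ = (∫ x in Ω, phaseFun p q μ x ‖D u x‖) + ∫ x in Ω, phaseFun p q μ x ‖D w x‖ :=
      integral_add (hD.integrableOn_phaseFun u) (hD.integrableOn_phaseFun w)
    _ ≤ _ := by
      gcongr
      exact hD.integral_phaseFun_le_one hw

/-- The double phase operator `A`, with values in the dual space. -/
noncomputable def operator (hD : IsContractionIntoLH h D) (u : V) : StrongDual ℝ V :=
  (hD.pairing u).mkContinuous _ (hD.abs_pairing_le u)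

theorem operator_apply (hD : IsContractionIntoLH h D) (u v : V) :
    hD.operator u v = ∫ x in Ω, fluxPairing p q μ (D u) (D v) x := rfl

/-- Both `v` in the open unit ball and `r⁻¹ • (w - u)` have images of modular at most `1`; these
account for the `1` next to `ε` and for the factor `2`. -/
theorem norm_operator_sub_le (hD : IsContractionIntoLH h D) {a b ε C r : ℝ}
    (hab : ∀ x ∈ Ω, a ≤ p x ∧ a ≤ q x ∧ p x ≤ b ∧ q x ≤ b) (hε : 0 ≤ ε) (hC : 0 ≤ C)
    (hr : 0 < r) (hr1 : r ≤ 1)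
    (hF : ∀ e : ℝ, 1 < e → e ≤ b → ∀ ξ θ : F,
      ‖‖θ‖ ^ (e - 2) • θ - ‖ξ‖ ^ (e - 2) • ξ‖ ≤ ε * ‖ξ‖ ^ (e - 1) + C * ‖θ - ξ‖ ^ (e - 1))
    {u w : V} (hwu : ‖w - u‖ < r) :
    ‖hD.operator w - hD.operator u‖ ≤
      ε * ((∫ x in Ω, phaseFun p q μ x ‖D u x‖) + 1) + C * r ^ (a - 1) * 2 := by
  have hM : 0 ≤ ε * ((∫ x in Ω, phaseFun p q μ x ‖D u x‖) + 1) + C * r ^ (a - 1) * 2 := by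
    have := h.integral_phaseFun_nonneg (D u)
    positivity
  refine ContinuousLinearMap.opNorm_le_bound _ hM fun v => ?_
  refine abs_le_mul_norm_of_ball (hD.operator w - hD.operator u).toLinearMap hM
    (fun v hv => ?_) v
  have hr' : ‖r⁻¹ • (w - u)‖ < 1 := by
    rwa [norm_smul, Real.norm_of_nonneg (by positivity), inv_mul_lt_iff₀ hr, mul_one]
  have iu := hD.integrableOn_phaseFun u
  have iv := hD.integrableOn_phaseFun v
  have iz := hD.integrableOn_phaseFun (r⁻¹ • (w - u))
  have ow := hD.integrableOn_fluxPairing w v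
  have ou := hD.integrableOn_fluxPairing u v
  have hle : ∀ᵐ x ∂(volume.restrict Ω),
      |fluxPairing p q μ (D w) (D v) x - fluxPairing p q μ (D u) (D v) x| ≤
        ε * (phaseFun p q μ x ‖D u x‖ + phaseFun p q μ x ‖D v x‖) + C * r ^ (a - 1) *
          (phaseFun p q μ x ‖D (r⁻¹ • (w - u)) x‖ + phaseFun p q μ x ‖D v x‖) := by
    filter_upwards [h.abs_fluxPairing_sub_le hab hε hC hr hr1 hF (D u) (D w) (D v),
      coeFn_map_smul (D := D) r⁻¹ (w - u), coeFn_map_sub (D := D) w u] with x h1 h2 h3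
    rwa [h2, h3]
  calc |hD.operator w v - hD.operator u v|
      = |∫ x in Ω, (fluxPairing p q μ (D w) (D v) x - fluxPairing p q μ (D u) (D v) x)| := by
        rw [operator_apply, operator_apply, integral_sub ow ou]
    _ ≤ ∫ x in Ω, |fluxPairing p q μ (D w) (D v) x - fluxPairing p q μ (D u) (D v) x| :=
        abs_integral_le_integral_abs
    _ ≤ _ := integral_mono_ae (ow.sub ou).abs
        (((iu.add iv).const_mul ε).add ((iz.add iv).const_mul (C * r ^ (a - 1)))) hle
    _ = ε * ((∫ x in Ω, phaseFun p q μ x ‖D u x‖) + ∫ x in Ω, phaseFun p q μ x ‖D v x‖) +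
        C * r ^ (a - 1) * ((∫ x in Ω, phaseFun p q μ x ‖D (r⁻¹ • (w - u)) x‖) +
          ∫ x in Ω, phaseFun p q μ x ‖D v x‖) := by
        rw [← integral_add iu iv, ← integral_add iz iv, ← integral_const_mul,
          ← integral_const_mul]
        exact integral_add ((iu.add iv).const_mul ε) ((iz.add iv).const_mul (C * r ^ (a - 1)))
    _ ≤ _ := by
        have hv1 := hD.integral_phaseFun_le_one hv
        have hz1 := hD.integral_phaseFun_le_one hr'
        gcongr
        linarith

theorem continuous_operator (hD : IsContractionIntoLH h D) : Continuous hD.operator := by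
  obtain ⟨a, b, ha, hab⟩ := h.exists_exponent_bounds
  refine continuous_iff_continuousAt.2 fun u => Metric.continuousAt_iff.2 fun ε hε => ?_
  set M := (∫ x in Ω, phaseFun p q μ x ‖D u x‖) + 1 with hM
  have hM0 : 0 < M := add_pos_of_nonneg_of_pos (h.integral_phaseFun_nonneg _) one_pos
  -- The order of choices matters: `M` depends on `u` alone, so `ε / (2 M)` fixes `C` first, and `r`
  -- is then taken small against `C`, which is possible because `a > 1`.
  obtain ⟨C, hC, hF⟩ := exists_norm_rpow_smul_sub_le F b (ε := ε / (2 * M)) (by positivity)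
  have hlim : Tendsto (fun r : ℝ => C * r ^ (a - 1) * 2) (𝓝[>] 0) (𝓝 0) := by
    have h1 : ContinuousAt (fun r : ℝ => r ^ (a - 1)) 0 :=
      Real.continuousAt_rpow_const _ _ (Or.inr (by linarith))
    have h2 : Tendsto (fun r : ℝ => C * r ^ (a - 1) * 2) (𝓝 0)
        (𝓝 (C * (0 : ℝ) ^ (a - 1) * 2)) := (h1.tendsto.const_mul C).mul_const 2
    rw [Real.zero_rpow (by linarith), mul_zero, zero_mul] at h2
    exact h2.mono_left nhdsWithin_le_nhds
  obtain ⟨r, hr2, hr0, hr1⟩ := ((hlim.eventually (gt_mem_nhds (half_pos hε))).and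
    (Ioc_mem_nhdsGT (zero_lt_one' ℝ))).exists
  refine ⟨r, hr0, fun {w} hw => ?_⟩
  rw [dist_eq_norm] at hw ⊢
  have h1 := hD.norm_operator_sub_le hab (by positivity) hC hr0 hr1 hF hw
  have h2 : ε / (2 * M) * M = ε / 2 := by field_simp
  rw [← hM, h2] at h1
  linarith

/-- The subgradient inequality for the energy, a consequence of its convexity. -/
theorem operator_sub_le (hD : IsContractionIntoLH h D) (u w : V) :
    hD.operator u (w - u) ≤
      (∫ x in Ω, energyDensity p q μ (D w) x) - ∫ x in Ω, energyDensity p q μ (D u) x := by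
  have iw := hD.integrableOn_energyDensity w
  have iu := hD.integrableOn_energyDensity u
  rw [operator_apply, ← integral_sub iw iu]
  refine integral_mono_ae (hD.integrableOn_fluxPairing u (w - u)) (iw.sub iu) ?_
  filter_upwards [h.fluxPairing_sub_le (D u) (D w), coeFn_map_sub (D := D) w u] with x h1 h2
  simpa only [fluxPairing, h2] using h1

theorem hasFDerivAt_integral_energyDensity (hD : IsContractionIntoLH h D) (u : V) :
    HasFDerivAt (fun u => ∫ x in Ω, energyDensity p q μ (D u) x) (hD.operator u) u :=
  hasFDerivAt_of_subgradient hD.continuous_operator.continuousAt hD.operator_sub_le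

end IsContractionIntoLH

end Operator

/-! ### The weak gradient as a contraction -/

section Gradient

variable {N : ℕ} {Ω : Set (EuclideanSpace ℝ (Fin N))} {p q μ : EuclideanSpace ℝ (Fin N) → ℝ}

/-- The weak gradient as a linear map on `W₀^{1,H}(Ω)`. -/
noncomputable def gradLinear (h : Condition Ω p q μ) :
    FieldMap Ω (EuclideanSpace ℝ (Fin N)) (W01H h) where
  toFun u := u.1.1.snd.1
  map_add' _ _ := rfl
  map_smul' _ _ := rfl

/-- The `ℓ¹`-product norm contains the Luxemburg norm of the gradient as a summand. -/
theorem isContractionIntoLH_gradLinear (h : Condition Ω p q μ) :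
    IsContractionIntoLH h (gradLinear h) where
  hasFiniteModular u := u.1.1.snd.2
  luxNorm_le u :=
    calc ‖u.1.1.snd‖ ≤ ‖u.1.1.fst‖ + ‖u.1.1.snd‖ := le_add_of_nonneg_left (norm_nonneg _)
      _ = ‖u.1.1‖ := (WithLp.prod_norm_eq_of_L1 u.1.1).symm

end Gradient

end DoublePhase

theorem mainTheorem12 {N : ℕ} {Ω : Set (EuclideanSpace ℝ (Fin N))}
    {p q μ : EuclideanSpace ℝ (Fin N) → ℝ} (h : DoublePhase.Condition Ω p q μ) :
    (∀ u : DoublePhase.W01H h, IntegrableOn (DoublePhase.energyIntegrand u) Ω) ∧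
    ContDiff ℝ 1 (DoublePhase.energy h) ∧
    ∃ A : DoublePhase.W01H h → StrongDual ℝ (DoublePhase.W01H h),
      DoublePhase.IsDoublePhaseOperator h A ∧
      ∀ u, HasFDerivAt (DoublePhase.energy h) (A u) u := by
  have hD := DoublePhase.isContractionIntoLH_gradLinear h
  -- `energyIntegrand` and `operatorIntegrand` are by definition `energyDensity` and `fluxPairing`
  -- of the fields `gradLinear h u`, so the abstract results apply without rewriting.
  have hF : ∀ u, HasFDerivAt (DoublePhase.energy h) (hD.operator u) u :=
    hD.hasFDerivAt_integral_energyDensity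
  exact ⟨hD.integrableOn_energyDensity,
    contDiff_one_iff_hasFDerivAt.2 ⟨hD.operator, hD.continuous_operator, hF⟩,
    hD.operator, fun u v => ⟨hD.integrableOn_fluxPairing u v, rfl⟩, hF⟩
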